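/- **Setting.** For $v\in\mathbb R^3$ let $v^\times$ be the skew-symmetric matrix with $v^\times w=v\times w$, and let $\mathrm{vex}$ be the inverse of $v\mapsto v^\times$. Let $m>0$, let $D\in\mathbb R^{3\times3}$ be symmetric positive definite, and let $\Phi$ be a $C^2$ function on $[0,\infty)$ with $\Phi(0)=0$ and $\Phi'>0$. The data at a time instant are a measured angular velocity $\Omega^m\in\mathbb R^3$, matrices $E,U^m\in\mathbb R^{3\times n}$ (whose columns are known inertial vectors and the corresponding vectors measured in the body frame) and a weight matrix $W\in\mathbb R^{n\times n}$. For $\hat R\in SO(3)$ put $$\mathcal U^0(\hat R,U^m)=\tfrac12\,\mathrm{trace}\big((E-\hat RU^m)^{T}(E-\hat RU^m)W\big),\qquad S_L(\hat R)=\mathrm{vex}(L^T\hat R-\hat R^TL),\quad L=EW(U^m)^T .$$ The continuous-time filter for $(\hat R,\omega)\in SO(3)\times\mathbb R^3$ is $$\dot{\hat R}=\hat R\,\hat\Omega^\times,\qquad m\dot\omega=-m\,\hat\Omega\times\omega+\Phi'(\mathcal U^0(\hat R,U^m))S_L(\hat R)-D\omega,\qquad \hat\Omega=\Omega^m-\omega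 .$$ The first-order Lie group variational integrator (LGVI) $\Xi_h:(\hat R_i,\omega_i)\mapsto(\hat R_{i+1},\omega_{i+1})$ is the implicit scheme $$\hat R_{i+1}=\hat R_i\exp(h\hat\Omega_i^\times),\qquad m\omega_{i+1}=\exp(-h\hat\Omega_{i+1}^\times)\big\{(mI-hD)\omega_i+h\Phi'(\mathcal U^0(\hat R_{i+1},U^m_{i+1}))S_{L_{i+1}}(\hat R_{i+1})\big\},$$ with $\hat\Omega_i=\Omega^m_i-\omega_i$. The adjoint of a method is $\Xi^*_h=(\Xi_{-h})^{-1}$ (with the data at the two ends of the step interchanged). Implicit methods are read as relations between the old and the new state. **The discrete filter.** Let $\Psi_h:(\hat R_i,\omega_i)\mapsto(\hat R_{i+1},\omega_{i+1})$ be given by $$\hat R_{i+1}=\hat R_i\exp\big(h(\Omega^m_{i+\frac12}-\omega_{i+\frac12})^\times\big),\qquad \Omega^m_{i+\frac12}=\tfrac12(\Omega^m_i+\Omega^m_{i+1}),$$ $$m\omega_{i+1}=\exp\big(-\tfrac h2\hat\Omega_{i+1}^\times\big)\Big\{\big(mI-\tfrac h2D\big)\omega_{i+\frac12}+\tfrac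 h2\Phi'(\mathcal U^0(\hat R_{i+1},U^m_{i+1}))S_{L_{i+1}}(\hat R_{i+1})\Big\},$$ $$\omega_{i+\frac12}=\big(mI+\tfrac h2D\big)^{-1}\Big\{\exp\big(-\tfrac h2\hat\Omega_i^\times\big)m\omega_i+\tfrac h2\Phi'(\mathcal U^0(\hat R_i,U^m_i))S_{L_i}(\hat R_i)\Big\}.$$ **Proposition.** (1) $mI+\frac h2D$ is invertible for every $h\ge0$. (2) Whenever $mI+\frac h2D$ is invertible, the half-step adjoint $\Xi^*_{h/2}$, taken from the data at $t_i$ to data with angular velocity $\Omega^m_{i+\frac12}$, is the explicit map $(\hat R_i,\omega_i)\mapsto\big(\hat R_i\exp(\tfrac h2(\Omega^m_{i+\frac12}-\omega_{i+\frac12})^\times),\,\omega_{i+\frac12}\big)$, with $\omega_{i+\frac12}$ given by the closed formula above. (3) Whenever $mI+\frac h2D$ is invertible, $\Psi_h=\Xi_{h/2}\circ\Xi^*_{h/2}$, where the midpoint angular velocity is $\Omega^m_{i+\frac12}=\tfrac12(\Omega^m_i+\Omega^m_{i+1})$. (4) $\Psi_h$ is symmetric: $\Psi_h^*=\Psi_h$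 whenever $mI+\frac h2D$ and $mI-\frac h2D$ are invertible. (5) Let the data be continuous functions of $t\in[t_0,T]$, $t_0<T$, with $W(t)$ symmetric positive definite. For every $M$ there is $h_0>0$ such that for $|h|\le h_0$, at all times $t,t+h\in[t_0,T]$ and from all states with $\|\omega\|\le M$, the implicit equations of $\Psi_h$ have exactly one solution, and $\Psi_{-h}\circ\Psi_h=\mathrm{id}$ there; and for $0<h\le h_0$ each initial state with $\|\omega_0\|\le M$ has exactly one discrete trajectory on every grid $t_i=t_0+ih$, $0\le i\le N$, in $[t_0,T]$. (6) If moreover $\Phi$ is $C^3$ on $[0,\infty)$ and the data are $C^2$ on $[t_0,T]$, then $\Psi_h$ is a second-order integrator for the continuous-time filter: for every $M$ there are $C$ and $h_0>0$ such that for all $0<h\le h_0$ - the local error after one step, started at time $t$ on an exact solution on $[t,t+h]\subset[t_0,T]$ with $\|\omega(t)\|\le M$, is at most $Ch^3$ in each component; - the global error $(\hat R_i,\omega_i)-(\hat R(t_i),\omega(t_i))$ of a discrete trajectory on a grid in $[t_0,T]$, started on an exact solution on $[t_0,T]$ with $\|\omega(t_0)\|\le M$, is at most $Ch^2$ in each component;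 - along such a trajectory $\omega_{i+\frac12}$ approximates $\omega(t_i+\frac h2)$ with error at most $Ch^2$ in each component. -/

import Mathlib

open Matrix Set

namespace AttitudeFilter

/-- The cross-product map `v ↦ v^×` from `ℝ³` to skew-symmetric matrices. -/
def hat (v : Fin 3 → ℝ) : Matrix (Fin 3) (Fin 3) ℝ :=
  !![0, -v 2, v 1; v 2, 0, -v 0; -v 1, v 0, 0]

/-- `vex`, the inverse of `v ↦ v^×` on skew-symmetric matrices. -/
def vex (A : Matrix (Fin 3) (Fin 3) ℝ) : Fin 3 → ℝ :=
  ![A 2 1, A 0 2, A 1 0]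

/-- The data available at one time instant: the measured angular velocity `Ω^m`, the matrix `E` of
known inertial vectors, the matrix `U^m` of the corresponding vectors measured in the body frame
(one column per vector), and the weight matrix `W`. -/
structure Measurement (n : ℕ) where
  Ω : Fin 3 → ℝ
  E : Matrix (Fin 3) (Fin n) ℝ
  U : Matrix (Fin 3) (Fin n) ℝ
  W : Matrix (Fin n) (Fin n) ℝ

/-- The filter state: the attitude estimate `R̂ ∈ SO(3)` and the angular velocity estimate
error `ω = Ω^m - Ω̂ ∈ ℝ³`. -/
@[ext] structure FilterState where
  R : Matrix.specialOrthogonalGroup (Fin 3) ℝ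
  ω : Fin 3 → ℝ

/-- The rotation matrix of a filter state. -/
def FilterState.rot (x : FilterState) : Matrix (Fin 3) (Fin 3) ℝ :=
  (x.R : Matrix (Fin 3) (Fin 3) ℝ)

/-- The estimated angular velocity `Ω̂ = Ω^m - ω`. -/
def estVel {n : ℕ} (a : Measurement n) (x : FilterState) : Fin 3 → ℝ :=
  a.Ω - x.ω

/-- Wahba's cost `U⁰(R̂, U^m) = ½ ⟨E - R̂ U^m, (E - R̂ U^m) W⟩` with the trace inner product
`⟨A, B⟩ = trace (Aᵀ B)`. -/
noncomputable def wahba {n : ℕ} (a : Measurement n) (x : FilterState) : ℝ :=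
  (1 / 2) * ((a.E - x.rot * a.U)ᵀ * ((a.E - x.rot * a.U) * a.W)).trace

/-- `S_L(R̂) = vex (Lᵀ R̂ - R̂ᵀ L)` with `L = E W (U^m)ᵀ`. -/
def wahbaGrad {n : ℕ} (a : Measurement n) (x : FilterState) : Fin 3 → ℝ :=
  vex ((a.E * a.W * a.Uᵀ)ᵀ * x.rot - x.rotᵀ * (a.E * a.W * a.Uᵀ))

/-- The term `Φ'(U⁰(R̂, U^m)) S_L(R̂)`; `Φ` is a function on `[0, ∞)`. -/
noncomputable def forcing {n : ℕ} (Φ : ℝ → ℝ) (a : Measurement n) (x : FilterState) : Fin 3 → ℝ :=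
  derivWithin Φ (Ici 0) (wahba a x) • wahbaGrad a x

/-- `Φ : [0, ∞) → [0, ∞)` is `C²` with `Φ(0) = 0` and `Φ' > 0`. -/
structure IsShapeFunction (Φ : ℝ → ℝ) : Prop where
  contDiffOn : ContDiffOn ℝ 2 Φ (Ici 0)
  map_zero : Φ 0 = 0
  deriv_pos : ∀ x ∈ Ici (0 : ℝ), 0 < derivWithin Φ (Ici 0) x

/-- The measurement signal is `C^r` on `[t₀, T]` (continuous for `r = 0`). -/
structure IsSmoothSignal {n : ℕ} (r : ℕ) (s : ℝ → Measurement n) (t₀ T : ℝ) : Prop where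
  Ω : ∀ i, ContDiffOn ℝ r (fun t => (s t).Ω i) (Icc t₀ T)
  E : ∀ i j, ContDiffOn ℝ r (fun t => (s t).E i j) (Icc t₀ T)
  U : ∀ i j, ContDiffOn ℝ r (fun t => (s t).U i j) (Icc t₀ T)
  W : ∀ i j, ContDiffOn ℝ r (fun t => (s t).W i j) (Icc t₀ T)

/-- `x` solves on `[a, b]` the continuous-time filter
`R̂' = R̂ (Ω^m - ω)^×`, `m ω' = -m Ω̂ × ω + Φ'(U⁰(R̂, U^m)) S_L(R̂) - D ω`, `Ω̂ = Ω^m - ω`. -/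
def IsFilterSolution {n : ℕ} (Φ : ℝ → ℝ) (m : ℝ) (D : Matrix (Fin 3) (Fin 3) ℝ)
    (s : ℝ → Measurement n) (a b : ℝ) (x : ℝ → FilterState) : Prop :=
  ∀ t ∈ Icc a b,
    (∀ i j, HasDerivWithinAt (fun τ => (x τ).rot i j)
      (((x t).rot * hat (estVel (s t) (x t))) i j) (Icc a b) t) ∧
    HasDerivWithinAt (fun τ => m • (x τ).ω)
      (-(m • crossProduct (estVel (s t) (x t)) (x t).ω) + forcing Φ (s t) (x t) - D *ᵥ (x t).ω)
      (Icc a b) t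

/-- A (possibly implicit) one-step method. `Ξ h a b x y` says that one step of length `h`, from a
time at which the data are `a` to a time at which the data are `b`, takes the state `x` to `y`. -/
abbrev Method (n : ℕ) : Type :=
  ℝ → Measurement n → Measurement n → FilterState → FilterState → Prop

/-- The adjoint method `Ξ*_h = (Ξ_{-h})⁻¹`. -/
def Method.adjoint {n : ℕ} (Ξ : Method n) : Method n :=
  fun h a b x y => Ξ (-h) b a y x

/-- The composition `Ξ_{h/2} ∘ Ξ*_{h/2}`: first a half step of the adjoint, from data `a` to the
data `c` at the midpoint, then a half step of `Ξ` from `c` to `b`. -/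
def strang {n : ℕ} (Ξ : Method n) (h : ℝ) (a c b : Measurement n) (x y : FilterState) : Prop :=
  ∃ z, Ξ.adjoint (h / 2) a c x z ∧ Ξ (h / 2) c b z y

/-- The implicit first-order Lie group variational integrator
`R̂₁ = R̂₀ exp (h Ω̂₀^×)`,
`m ω₁ = exp (-h Ω̂₁^×) {(m I - h D) ω₀ + h Φ'(U⁰(R̂₁, U^m₁)) S_{L₁}(R̂₁)}`. -/
def lgvi {n : ℕ} (Φ : ℝ → ℝ) (m : ℝ) (D : Matrix (Fin 3) (Fin 3) ℝ) : Method n :=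
  fun h a b x y =>
    y.rot = x.rot * NormedSpace.exp (h • hat (estVel a x)) ∧
    m • y.ω = NormedSpace.exp (-h • hat (estVel b y)) *ᵥ
      ((m • (1 : Matrix (Fin 3) (Fin 3) ℝ) - h • D) *ᵥ x.ω + h • forcing Φ b y)

/-- The explicit intermediate value
`ω_{1/2} = (m I + (h/2) D)⁻¹ {exp (-(h/2) Ω̂₀^×) m ω₀ + (h/2) Φ'(U⁰(R̂₀, U^m₀)) S_{L₀}(R̂₀)}`. -/
noncomputable def midVel {n : ℕ} (Φ : ℝ → ℝ) (m : ℝ) (D : Matrix (Fin 3) (Fin 3) ℝ)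
    (h : ℝ) (a : Measurement n) (x : FilterState) : Fin 3 → ℝ :=
  (m • (1 : Matrix (Fin 3) (Fin 3) ℝ) + (h / 2) • D)⁻¹ *ᵥ
    (NormedSpace.exp (-(h / 2) • hat (estVel a x)) *ᵥ (m • x.ω) + (h / 2) • forcing Φ a x)

/-- The average `Ω^m_{1/2} = ½ (Ω^m₀ + Ω^m₁)`. -/
noncomputable def midΩ {n : ℕ} (a b : Measurement n) : Fin 3 → ℝ :=
  (1 / 2 : ℝ) • (a.Ω + b.Ω)

/-- The second-order discrete-time filter
`R̂₁ = R̂₀ exp (h (Ω^m_{1/2} - ω_{1/2})^×)`,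
`m ω₁ = exp (-(h/2) Ω̂₁^×) {(m I - (h/2) D) ω_{1/2} + (h/2) Φ'(U⁰(R̂₁, U^m₁)) S_{L₁}(R̂₁)}`. -/
def filter2 {n : ℕ} (Φ : ℝ → ℝ) (m : ℝ) (D : Matrix (Fin 3) (Fin 3) ℝ) : Method n :=
  fun h a b x y =>
    y.rot = x.rot * NormedSpace.exp (h • hat (midΩ a b - midVel Φ m D h a x)) ∧
    m • y.ω = NormedSpace.exp (-(h / 2) • hat (estVel b y)) *ᵥ
      ((m • (1 : Matrix (Fin 3) (Fin 3) ℝ) - (h / 2) • D) *ᵥ midVel Φ m D h a x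
        + (h / 2) • forcing Φ b y)

/-- `x 0, …, x N` is produced by the method on the grid `t₀ + i h`, `0 ≤ i ≤ N`. -/
def IsTrajectory {n : ℕ} (Ψ : Method n) (s : ℝ → Measurement n) (t₀ h : ℝ) (N : ℕ)
    (x : Fin (N + 1) → FilterState) : Prop :=
  ∀ i : Fin N, Ψ h (s (t₀ + (i : ℕ) * h)) (s (t₀ + ((i : ℕ) + 1) * h)) (x i.castSucc) (x i.succ)

/-- Two states agree up to `ε`, entry by entry. -/
def ErrorLE (x y : FilterState) (ε : ℝ) : Prop :=
  (∀ i j, |x.rot i j - y.rot i j| ≤ ε) ∧ ∀ i, |x.ω i - y.ω i| ≤ ε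

/-- On the time interval `[t₀, T]` the method defines, for small steps of either sign and locally
uniformly in the state, a map `Ψ_h`, and `Ψ_{-h} ∘ Ψ_h = id`. -/
def IsReversibleMap {n : ℕ} (Ψ : Method n) (s : ℝ → Measurement n) (t₀ T : ℝ) : Prop :=
  ∀ M : ℝ, ∃ h₀ > 0, ∀ h, |h| ≤ h₀ → ∀ t, t ∈ Icc t₀ T → t + h ∈ Icc t₀ T →
    ∀ x : FilterState, ‖x.ω‖ ≤ M →
      ∃ y, (∀ y', Ψ h (s t) (s (t + h)) x y' ↔ y' = y) ∧
        ∀ w, Ψ (-h) (s (t + h)) (s t) y w ↔ w = x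

/-- For small steps the method determines exactly one discrete trajectory on the whole grid from
each initial state. -/
def IsWellPosed {n : ℕ} (Ψ : Method n) (s : ℝ → Measurement n) (t₀ T : ℝ) : Prop :=
  ∀ M : ℝ, ∃ h₀ > 0, ∀ h, 0 < h → h ≤ h₀ → ∀ N : ℕ, t₀ + N * h ≤ T →
    ∀ x₀ : FilterState, ‖x₀.ω‖ ≤ M →
      ∃! x : Fin (N + 1) → FilterState, x 0 = x₀ ∧ IsTrajectory Ψ s t₀ h N x

/-- Consistency of order `p`: the local error is `O(h^{p+1})`, uniformly for initial states in
bounded sets and initial times in `[t₀, T]`. -/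
def HasLocalOrder {n : ℕ} (p : ℕ) (Ψ : Method n) (Φ : ℝ → ℝ) (m : ℝ)
    (D : Matrix (Fin 3) (Fin 3) ℝ) (s : ℝ → Measurement n) (t₀ T : ℝ) : Prop :=
  ∀ M : ℝ, ∃ C : ℝ, ∃ h₀ > 0, ∀ h, 0 < h → h ≤ h₀ → ∀ t, t₀ ≤ t → t + h ≤ T →
    ∀ x : ℝ → FilterState, IsFilterSolution Φ m D s t (t + h) x → ‖(x t).ω‖ ≤ M →
      ∀ y, Ψ h (s t) (s (t + h)) (x t) y → ErrorLE y (x (t + h)) (C * h ^ (p + 1))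

/-- Convergence of order `p`: the global error on `[t₀, T]` is `O(h^p)`. -/
def HasGlobalOrder {n : ℕ} (p : ℕ) (Ψ : Method n) (Φ : ℝ → ℝ) (m : ℝ)
    (D : Matrix (Fin 3) (Fin 3) ℝ) (s : ℝ → Measurement n) (t₀ T : ℝ) : Prop :=
  ∀ M : ℝ, ∃ C : ℝ, ∃ h₀ > 0, ∀ h, 0 < h → h ≤ h₀ → ∀ N : ℕ, t₀ + N * h ≤ T →
    ∀ x : ℝ → FilterState, IsFilterSolution Φ m D s t₀ T x → ‖(x t₀).ω‖ ≤ M →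
      ∀ y : Fin (N + 1) → FilterState, y 0 = x t₀ → IsTrajectory Ψ s t₀ h N y →
        ∀ i : Fin (N + 1), ErrorLE (y i) (x (t₀ + (i : ℕ) * h)) (C * h ^ p)

/-- The intermediate values `ω_{i+1/2}` computed along a discrete trajectory approximate the exact
`ω(t_i + h/2)` up to `O(h²)`. -/
def MidVelApproximates {n : ℕ} (Φ : ℝ → ℝ) (m : ℝ)
    (D : Matrix (Fin 3) (Fin 3) ℝ) (s : ℝ → Measurement n) (t₀ T : ℝ) : Prop :=
  ∀ M : ℝ, ∃ C : ℝ, ∃ h₀ > 0, ∀ h, 0 < h → h ≤ h₀ → ∀ N : ℕ, t₀ + N * h ≤ T →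
    ∀ x : ℝ → FilterState, IsFilterSolution Φ m D s t₀ T x → ‖(x t₀).ω‖ ≤ M →
      ∀ y : Fin (N + 1) → FilterState, y 0 = x t₀ → IsTrajectory (filter2 Φ m D) s t₀ h N y →
        ∀ i : Fin N, ∀ k, |midVel Φ m D h (s (t₀ + (i : ℕ) * h)) (y i.castSucc) k
          - (x (t₀ + (i : ℕ) * h + h / 2)).ω k| ≤ C * h ^ 2

end AttitudeFilter

namespace AttitudeFilter

/-! ### Algebra of the scheme: adjoint half step and symmetry. -/

section Algebra

variable {n : ℕ}

theorem hat_neg (v : Fin 3 → ℝ) : hat (-v) = -hat v := by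
  ext i j; fin_cases i <;> fin_cases j <;> simp [hat]

theorem hat_add (v w : Fin 3 → ℝ) : hat (v + w) = hat v + hat w := by
  ext i j; fin_cases i <;> fin_cases j <;> simp [hat] <;> ring

theorem hat_zero : hat 0 = 0 := by
  ext i j; fin_cases i <;> fin_cases j <;> simp [hat]

theorem hat_sub (v w : Fin 3 → ℝ) : hat (v - w) = hat v - hat w := by
  rw [sub_eq_add_neg, hat_add, hat_neg, sub_eq_add_neg]

theorem hat_smul (c : ℝ) (v : Fin 3 → ℝ) : hat (c • v) = c • hat v := by
  ext i j; fin_cases i <;> fin_cases j <;> simp [hat]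

theorem hat_transpose (v : Fin 3 → ℝ) : (hat v)ᵀ = -hat v := by
  ext i j; fin_cases i <;> fin_cases j <;> simp [hat]

theorem hat_mulVec (v w : Fin 3 → ℝ) : hat v *ᵥ w = crossProduct v w := by
  ext i; fin_cases i <;> simp [hat, Matrix.mulVec, dotProduct, Fin.sum_univ_three, cross_apply] <;>
    ring

theorem exp_smul_mul_exp_neg_smul (c : ℝ) (A : Matrix (Fin 3) (Fin 3) ℝ) :
    NormedSpace.exp (c • A) * NormedSpace.exp (-c • A) = 1 := by
  rw [← Matrix.exp_add_of_commute _ _ (by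
    rw [neg_smul]; exact (Commute.refl _).neg_right), neg_smul, add_neg_cancel,
    NormedSpace.exp_zero]

theorem exp_neg_smul_mul_exp_smul (c : ℝ) (A : Matrix (Fin 3) (Fin 3) ℝ) :
    NormedSpace.exp (-c • A) * NormedSpace.exp (c • A) = 1 := by
  simpa using exp_smul_mul_exp_neg_smul (-c) A

theorem eq_exp_mulVec_iff (c : ℝ) (A : Matrix (Fin 3) (Fin 3) ℝ) (u v : Fin 3 → ℝ) :
    u = NormedSpace.exp (-c • A) *ᵥ v ↔ NormedSpace.exp (c • A) *ᵥ u = v := by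
  constructor
  · rintro rfl
    rw [Matrix.mulVec_mulVec, exp_smul_mul_exp_neg_smul, Matrix.one_mulVec]
  · rintro rfl
    rw [Matrix.mulVec_mulVec, exp_neg_smul_mul_exp_smul, Matrix.one_mulVec]

theorem eq_mul_exp_iff (c : ℝ) (A X Y : Matrix (Fin 3) (Fin 3) ℝ) :
    X = Y * NormedSpace.exp (-c • A) ↔ Y = X * NormedSpace.exp (c • A) := by
  constructor
  · rintro rfl
    rw [Matrix.mul_assoc, exp_neg_smul_mul_exp_smul, Matrix.mul_one]
  · rintro rfl
    rw [Matrix.mul_assoc, exp_smul_mul_exp_neg_smul, Matrix.mul_one]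

theorem eq_inv_mulVec_iff {A : Matrix (Fin 3) (Fin 3) ℝ} (hA : IsUnit A) (u v : Fin 3 → ℝ) :
    u = A⁻¹ *ᵥ v ↔ A *ᵥ u = v := by
  have hd := (Matrix.isUnit_iff_isUnit_det A).1 hA
  constructor
  · rintro rfl
    rw [Matrix.mulVec_mulVec, Matrix.mul_nonsing_inv _ hd, Matrix.one_mulVec]
  · rintro rfl
    rw [Matrix.mulVec_mulVec, Matrix.nonsing_inv_mul _ hd, Matrix.one_mulVec]

theorem eq_midVel_iff {Φ : ℝ → ℝ} {m : ℝ} {D : Matrix (Fin 3) (Fin 3) ℝ} {h : ℝ}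
    {a : Measurement n} {x : FilterState} {w : Fin 3 → ℝ}
    (hu : IsUnit (m • (1 : Matrix (Fin 3) (Fin 3) ℝ) + (h / 2) • D)) :
    w = midVel Φ m D h a x ↔ (m • (1 : Matrix (Fin 3) (Fin 3) ℝ) + (h / 2) • D) *ᵥ w =
      NormedSpace.exp (-(h / 2) • hat (estVel a x)) *ᵥ (m • x.ω) + (h / 2) • forcing Φ a x :=
  eq_inv_mulVec_iff hu _ _

/-- Moving the rotation to the other side turns the closed formula into the velocity equation of an
LGVI step of length `-h/2`; this is the form in which the adjoint and the symmetry are read off. -/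
theorem eq_midVel_iff' {Φ : ℝ → ℝ} {m : ℝ} {D : Matrix (Fin 3) (Fin 3) ℝ} {h : ℝ}
    {a : Measurement n} {x : FilterState} {w : Fin 3 → ℝ}
    (hu : IsUnit (m • (1 : Matrix (Fin 3) (Fin 3) ℝ) + (h / 2) • D)) :
    w = midVel Φ m D h a x ↔ m • x.ω = NormedSpace.exp ((h / 2) • hat (estVel a x)) *ᵥ
      ((m • (1 : Matrix (Fin 3) (Fin 3) ℝ) + (h / 2) • D) *ᵥ w - (h / 2) • forcing Φ a x) := by
  rw [eq_midVel_iff hu]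
  have := eq_exp_mulVec_iff (-(h / 2)) (hat (estVel a x)) (m • x.ω)
    ((m • (1 : Matrix (Fin 3) (Fin 3) ℝ) + (h / 2) • D) *ᵥ w - (h / 2) • forcing Φ a x)
  rw [neg_neg] at this
  rw [this, eq_sub_iff_add_eq, eq_comm]

theorem isUnit_smul_one_add_smul {m : ℝ} (hm : 0 < m) {D : Matrix (Fin 3) (Fin 3) ℝ}
    (hD : D.PosDef) {h : ℝ} (hh : 0 ≤ h) :
    IsUnit (m • (1 : Matrix (Fin 3) (Fin 3) ℝ) + (h / 2) • D) :=
  ((Matrix.PosDef.one.smul hm).add_posSemidef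
    (hD.posSemidef.smul (by positivity))).isUnit

/-- Interchanging the states puts the known velocity `x.ω` into the exponential of the velocity
equation, so the equation is linear in `z.ω`. -/
theorem lgvi_adjoint_iff {Φ : ℝ → ℝ} {m : ℝ} {D : Matrix (Fin 3) (Fin 3) ℝ} {h : ℝ}
    {a c : Measurement n} {x z : FilterState}
    (hu : IsUnit (m • (1 : Matrix (Fin 3) (Fin 3) ℝ) + (h / 2) • D)) :
    (lgvi Φ m D).adjoint (h / 2) a c x z ↔ z.ω = midVel Φ m D h a x ∧
      z.rot = x.rot * NormedSpace.exp ((h / 2) • hat (c.Ω - midVel Φ m D h a x)) := by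
  have key : (lgvi Φ m D).adjoint (h / 2) a c x z ↔
      z.rot = x.rot * NormedSpace.exp ((h / 2) • hat (c.Ω - z.ω)) ∧
      z.ω = midVel Φ m D h a x := by
    rw [eq_midVel_iff' hu, ← eq_mul_exp_iff]
    simp only [Method.adjoint, lgvi, neg_neg, neg_smul, sub_neg_eq_add, ← sub_eq_add_neg, estVel]
  rw [key, and_comm]
  exact and_congr_right fun h => by rw [h]

theorem ext_rot {x y : FilterState} (hR : x.rot = y.rot) (hω : x.ω = y.ω) : x = y :=
  FilterState.ext (Subtype.ext hR) hω

/-- The velocity update is equivalent to `midVel` at `x` with step `h` being `midVel` at `y` with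
step `-h`. This condition and the rotation update are both invariant under the reversal; the two
invertibility assumptions make the two midpoint velocities meaningful. -/
theorem filter2_symm {Φ : ℝ → ℝ} {m : ℝ} {D : Matrix (Fin 3) (Fin 3) ℝ} {h : ℝ}
    {a b : Measurement n} {x y : FilterState}
    (hu : IsUnit (m • (1 : Matrix (Fin 3) (Fin 3) ℝ) + (h / 2) • D))
    (hu' : IsUnit (m • (1 : Matrix (Fin 3) (Fin 3) ℝ) - (h / 2) • D)) :
    filter2 Φ m D (-h) b a y x ↔ filter2 Φ m D h a b x y := by
  have hu'' : IsUnit (m • (1 : Matrix (Fin 3) (Fin 3) ℝ) + (-h / 2) • D) := by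
    rwa [neg_div, neg_smul, ← sub_eq_add_neg]
  have h1 : ∀ w, w = midVel Φ m D (-h) b y ↔
      m • y.ω = NormedSpace.exp (-(h / 2) • hat (estVel b y)) *ᵥ
      ((m • (1 : Matrix (Fin 3) (Fin 3) ℝ) - (h / 2) • D) *ᵥ w + (h / 2) • forcing Φ b y) := by
    intro w
    rw [eq_midVel_iff' hu'']
    simp only [neg_div, neg_smul, sub_neg_eq_add, ← sub_eq_add_neg]
  have h2 : ∀ w, w = midVel Φ m D h a x ↔
      m • x.ω = NormedSpace.exp (-(-h / 2) • hat (estVel a x)) *ᵥ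
      ((m • (1 : Matrix (Fin 3) (Fin 3) ℝ) - (-h / 2) • D) *ᵥ w + (-h / 2) • forcing Φ a x) := by
    intro w
    rw [eq_midVel_iff' hu]
    simp only [neg_div, neg_smul, sub_neg_eq_add, ← sub_eq_add_neg, neg_neg]
  rw [filter2, filter2, ← h1, ← h2, eq_mul_exp_iff]
  have : midΩ b a = midΩ a b := by simp [midΩ, add_comm]
  rw [this]
  constructor
  · rintro ⟨hR, hw⟩
    exact ⟨hw ▸ hR, hw.symm⟩
  · rintro ⟨hR, hw⟩
    exact ⟨hw ▸ hR, hw.symm⟩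

end Algebra

/-! ### Rotations and the composition of the half steps. -/

section Rotations

theorem exp_hat_mem (v : Fin 3 → ℝ) :
    NormedSpace.exp (hat v) ∈ Matrix.specialOrthogonalGroup (Fin 3) ℝ := by
  have key : ∀ v : Fin 3 → ℝ,
      NormedSpace.exp (hat v) * (NormedSpace.exp (hat v))ᵀ = 1 := by
    intro v
    rw [← Matrix.exp_transpose, hat_transpose]
    simpa using exp_smul_mul_exp_neg_smul 1 (hat v)
  rw [Matrix.mem_specialOrthogonalGroup_iff, Matrix.mem_orthogonalGroup_iff]
  refine ⟨key v, ?_⟩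
  -- Orthogonality leaves the sign of the determinant open. With `Q = exp (hat (v/2))`, the
  -- determinant of `exp (hat v) = Q * Q` equals that of `Q * Qᵀ = 1`.
  have h1 : NormedSpace.exp (hat v) =
      NormedSpace.exp (hat ((1 / 2 : ℝ) • v)) * NormedSpace.exp (hat ((1 / 2 : ℝ) • v)) := by
    rw [← Matrix.exp_add_of_commute _ _ (Commute.refl _), ← hat_add, ← add_smul]
    norm_num
  have h2 := congrArg Matrix.det (key ((1 / 2 : ℝ) • v))
  rw [Matrix.det_mul, Matrix.det_transpose, Matrix.det_one] at h2
  rw [h1, Matrix.det_mul, h2]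

/-- The state `(R exp (v^×), w)`. -/
noncomputable def FilterState.advance (x : FilterState) (v w : Fin 3 → ℝ) : FilterState :=
  ⟨x.R * ⟨NormedSpace.exp (hat v), exp_hat_mem v⟩, w⟩

theorem FilterState.advance_rot (x : FilterState) (v w : Fin 3 → ℝ) :
    (x.advance v w).rot = x.rot * NormedSpace.exp (hat v) := rfl

theorem FilterState.advance_ω (x : FilterState) (v w : Fin 3 → ℝ) :
    (x.advance v w).ω = w := rfl

/-- Both half rotations have the generator `c.Ω - midVel`, so they merge into one full rotation. The
midpoint data enter only through `c.Ω`, since neither half step evaluates the forcing there. -/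
theorem strang_lgvi_iff {n : ℕ} {Φ : ℝ → ℝ} {m : ℝ} {D : Matrix (Fin 3) (Fin 3) ℝ} {h : ℝ}
    {a c b : Measurement n} {x y : FilterState}
    (hu : IsUnit (m • (1 : Matrix (Fin 3) (Fin 3) ℝ) + (h / 2) • D)) (hc : c.Ω = midΩ a b) :
    strang (lgvi Φ m D) h a c b x y ↔ filter2 Φ m D h a b x y := by
  have hexp : ∀ A : Matrix (Fin 3) (Fin 3) ℝ,
      NormedSpace.exp ((h / 2) • A) * NormedSpace.exp ((h / 2) • A) = NormedSpace.exp (h • A) := by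
    intro A
    rw [← Matrix.exp_add_of_commute _ _ (Commute.refl _), ← add_smul, add_halves]
  simp only [strang, lgvi_adjoint_iff hu]
  constructor
  · rintro ⟨z, ⟨hw, hz⟩, hy, hyω⟩
    rw [hw] at hyω
    refine ⟨?_, hyω⟩
    rw [hy, hz, estVel, hw, hc, Matrix.mul_assoc, hexp]
  · rintro ⟨hy, hyω⟩
    refine ⟨x.advance ((h / 2) • (c.Ω - midVel Φ m D h a x)) (midVel Φ m D h a x), ⟨rfl, ?_⟩, ?_, ?_⟩
    · rw [FilterState.advance_rot, hat_smul]
    · rw [FilterState.advance_rot, estVel, FilterState.advance_ω, hat_smul, Matrix.mul_assoc, hexp,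
        hy, hc]
    · exact hyω

end Rotations

/-! ### Euclidean and operator norms; Taylor remainders of the exponential. -/

section Norms

open scoped Matrix.Norms.L2Operator

/-- The Euclidean norm on `ℝ³`. -/
noncomputable def l2 (v : Fin 3 → ℝ) : ℝ := ‖(WithLp.toLp 2 v : EuclideanSpace ℝ (Fin 3))‖

theorem l2_nonneg (v : Fin 3 → ℝ) : 0 ≤ l2 v := norm_nonneg _

theorem l2_zero : l2 0 = 0 := by simp [l2]

theorem l2_eq_zero {v : Fin 3 → ℝ} : l2 v = 0 ↔ v = 0 := by simp [l2]

theorem l2_add_le (v w : Fin 3 → ℝ) : l2 (v + w) ≤ l2 v + l2 w := by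
  simpa [l2] using norm_add_le (WithLp.toLp 2 v : EuclideanSpace ℝ (Fin 3)) (WithLp.toLp 2 w)

theorem l2_sub_le (v w : Fin 3 → ℝ) : l2 (v - w) ≤ l2 v + l2 w := by
  simpa [l2] using norm_sub_le (WithLp.toLp 2 v : EuclideanSpace ℝ (Fin 3)) (WithLp.toLp 2 w)

theorem l2_neg (v : Fin 3 → ℝ) : l2 (-v) = l2 v := by simp [l2]

theorem l2_sub_comm (v w : Fin 3 → ℝ) : l2 (v - w) = l2 (w - v) := by
  rw [← l2_neg, neg_sub]

theorem l2_smul (c : ℝ) (v : Fin 3 → ℝ) : l2 (c • v) = |c| * l2 v := by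
  simp [l2, norm_smul]

theorem l2_smul_of_nonneg {c : ℝ} (hc : 0 ≤ c) (v : Fin 3 → ℝ) : l2 (c • v) = c * l2 v := by
  rw [l2_smul, abs_of_nonneg hc]

theorem l2_mulVec_le (A : Matrix (Fin 3) (Fin 3) ℝ) (v : Fin 3 → ℝ) :
    l2 (A *ᵥ v) ≤ ‖A‖ * l2 v :=
  Matrix.l2_opNorm_mulVec A (WithLp.toLp 2 v)

theorem l2_sq (v : Fin 3 → ℝ) : l2 v ^ 2 = v 0 ^ 2 + v 1 ^ 2 + v 2 ^ 2 := by
  simp [l2, EuclideanSpace.norm_sq_eq, Fin.sum_univ_three]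

theorem l2_sq_eq_dotProduct (v : Fin 3 → ℝ) : l2 v ^ 2 = v ⬝ᵥ v := by
  rw [l2_sq]; simp [dotProduct, Fin.sum_univ_three]; ring

theorem dotProduct_le_l2_mul_l2 (v w : Fin 3 → ℝ) : v ⬝ᵥ w ≤ l2 v * l2 w := by
  have := real_inner_le_norm (WithLp.toLp 2 w : EuclideanSpace ℝ (Fin 3)) (WithLp.toLp 2 v)
  simpa [l2, EuclideanSpace.inner_eq_star_dotProduct, mul_comm] using this

theorem abs_apply_le_l2 (v : Fin 3 → ℝ) (i : Fin 3) : |v i| ≤ l2 v := by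
  simpa [l2] using PiLp.norm_apply_le (WithLp.toLp 2 v : EuclideanSpace ℝ (Fin 3)) i

/-- The factor `2` stands for `√3`. -/
theorem l2_le_of_abs_apply_le {v : Fin 3 → ℝ} {c : ℝ} (h : ∀ i, |v i| ≤ c) :
    l2 v ≤ 2 * c := by
  have hc : 0 ≤ c := (abs_nonneg _).trans (h 0)
  have h0 := sq_le_sq' (abs_le.1 (h 0)).1 (abs_le.1 (h 0)).2
  have h1 := sq_le_sq' (abs_le.1 (h 1)).1 (abs_le.1 (h 1)).2
  have h2 := sq_le_sq' (abs_le.1 (h 2)).1 (abs_le.1 (h 2)).2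
  refine le_of_sq_le_sq ?_ (by positivity)
  rw [l2_sq]; nlinarith

theorem l2_le_norm (v : Fin 3 → ℝ) : l2 v ≤ 2 * ‖v‖ :=
  l2_le_of_abs_apply_le fun i => norm_le_pi_norm v i

theorem abs_entry_le_norm (A : Matrix (Fin 3) (Fin 3) ℝ) (i j : Fin 3) : |A i j| ≤ ‖A‖ := by
  have h1 : (A *ᵥ Pi.single j 1) i = A i j := by simp
  have h2 : l2 (Pi.single j 1) = 1 := by simp [l2]
  rw [← h1]
  exact (abs_apply_le_l2 _ i).trans ((l2_mulVec_le _ _).trans (by rw [h2, mul_one]))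

theorem norm_le_of_l2_mulVec_le {A : Matrix (Fin 3) (Fin 3) ℝ} {c : ℝ} (hc : 0 ≤ c)
    (h : ∀ v, l2 (A *ᵥ v) ≤ c * l2 v) : ‖A‖ ≤ c := by
  rw [← Matrix.l2_opNorm_toEuclideanCLM]
  exact ContinuousLinearMap.opNorm_le_bound _ hc fun v => h v.ofLp

theorem norm_le_of_abs_entry_le {A : Matrix (Fin 3) (Fin 3) ℝ} {c : ℝ}
    (h : ∀ i j, |A i j| ≤ c) : ‖A‖ ≤ 6 * c := by
  have hc : 0 ≤ c := (abs_nonneg _).trans (h 0 0)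
  refine norm_le_of_l2_mulVec_le (by positivity) fun v => ?_
  have : ∀ i, |(A *ᵥ v) i| ≤ 3 * c * l2 v := by
    intro i
    rw [Matrix.mulVec, dotProduct]
    refine (Finset.abs_sum_le_sum_abs _ _).trans ?_
    have : ∀ j ∈ Finset.univ, |A i j * v j| ≤ c * l2 v := fun j _ => by
      rw [abs_mul]
      exact mul_le_mul (h i j) (abs_apply_le_l2 v j) (abs_nonneg _) hc
    refine (Finset.sum_le_card_nsmul _ _ _ this).trans ?_
    simp; linarith
  refine (l2_le_of_abs_apply_le this).trans (le_of_eq (by ring))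

theorem norm_of_mem_specialOrthogonalGroup {A : Matrix (Fin 3) (Fin 3) ℝ}
    (hA : A ∈ Matrix.specialOrthogonalGroup (Fin 3) ℝ) : ‖A‖ = 1 :=
  CStarRing.norm_of_mem_unitary ((Matrix.mem_specialOrthogonalGroup_iff).1 hA).1

theorem norm_rot (x : FilterState) : ‖x.rot‖ = 1 := norm_of_mem_specialOrthogonalGroup x.R.2

theorem norm_exp_hat (v : Fin 3 → ℝ) : ‖NormedSpace.exp (hat v)‖ = 1 :=
  norm_of_mem_specialOrthogonalGroup (exp_hat_mem v)

theorem l2_exp_hat_mulVec (v w : Fin 3 → ℝ) : l2 (NormedSpace.exp (hat v) *ᵥ w) = l2 w := by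
  refine le_antisymm ?_ ?_
  · simpa [norm_exp_hat] using l2_mulVec_le (NormedSpace.exp (hat v)) w
  · have h := l2_mulVec_le (NormedSpace.exp (hat (-v))) (NormedSpace.exp (hat v) *ᵥ w)
    have h1 := exp_neg_smul_mul_exp_smul 1 (hat v)
    rw [neg_smul, one_smul, ← hat_neg] at h1
    rwa [norm_exp_hat, one_mul, Matrix.mulVec_mulVec, h1, Matrix.one_mulVec] at h

theorem norm_hat_le (v : Fin 3 → ℝ) : ‖hat v‖ ≤ l2 v := by
  refine norm_le_of_l2_mulVec_le (l2_nonneg v) fun w => ?_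
  refine le_of_sq_le_sq ?_ (mul_nonneg (l2_nonneg v) (l2_nonneg w))
  rw [mul_pow, l2_sq, l2_sq, l2_sq, hat_mulVec]
  simp only [cross_apply, Matrix.cons_val]
  nlinarith [sq_nonneg (v 0 * w 0 + v 1 * w 1 + v 2 * w 2)]

theorem norm_image_sub_le_of_hasDerivAt_le {E : Type*} [NormedAddCommGroup E] [NormedSpace ℝ E]
    {f f' : ℝ → E} {C : ℝ} (hf : ∀ t, HasDerivAt f (f' t) t)
    (hC : ∀ t ∈ Icc (0 : ℝ) 1, ‖f' t‖ ≤ C) : ‖f 1 - f 0‖ ≤ C := by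
  simpa using (convex_Icc (0 : ℝ) 1).norm_image_sub_le_of_norm_hasDerivWithin_le
    (fun t _ => (hf t).hasDerivWithinAt) hC (left_mem_Icc.2 zero_le_one)
    (right_mem_Icc.2 zero_le_one)

theorem hasDerivAt_exp_smul_hat (v : Fin 3 → ℝ) (t : ℝ) :
    HasDerivAt (fun t : ℝ => NormedSpace.exp (t • hat v))
      (NormedSpace.exp (t • hat v) * hat v) t :=
  hasDerivAt_exp_smul_const (hat v) t

/-- Along the path `exp (t v^×) exp ((1 - t) w^×)` the derivative is `(v - w)^×` between two
rotations. Hence the Lipschitz constant is `1` globally, with no exponential growth factor. -/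
theorem norm_exp_hat_sub_exp_hat_le (v w : Fin 3 → ℝ) :
    ‖NormedSpace.exp (hat v) - NormedSpace.exp (hat w)‖ ≤ l2 (v - w) := by
  have hd : ∀ t : ℝ, HasDerivAt
      (fun t : ℝ => NormedSpace.exp (t • hat v) * NormedSpace.exp ((1 - t) • hat w))
      (NormedSpace.exp (t • hat v) * hat (v - w) * NormedSpace.exp ((1 - t) • hat w)) t := by
    intro t
    have h2 : HasDerivAt (fun t : ℝ => NormedSpace.exp ((1 - t) • hat w))
        (-(hat w * NormedSpace.exp ((1 - t) • hat w))) t := by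
      have := (hasDerivAt_exp_smul_const' (hat w) (1 - t)).scomp t
        ((hasDerivAt_id t).const_sub 1)
      simpa [Function.comp_def] using this
    refine ((hasDerivAt_exp_smul_hat v t).mul h2).congr_deriv ?_
    rw [hat_sub]; noncomm_ring
  have hb : ∀ t ∈ Icc (0 : ℝ) 1, ‖NormedSpace.exp (t • hat v) * hat (v - w) *
      NormedSpace.exp ((1 - t) • hat w)‖ ≤ l2 (v - w) := by
    intro t _
    refine (norm_mul_le _ _).trans ?_
    rw [← hat_smul _ w, norm_exp_hat, mul_one]
    refine (norm_mul_le _ _).trans ?_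
    rw [← hat_smul, norm_exp_hat, one_mul]
    exact norm_hat_le _
  simpa [NormedSpace.exp_zero] using norm_image_sub_le_of_hasDerivAt_le hd hb

theorem norm_exp_hat_sub_one_le (v : Fin 3 → ℝ) : ‖NormedSpace.exp (hat v) - 1‖ ≤ l2 v := by
  simpa [hat_zero, NormedSpace.exp_zero] using norm_exp_hat_sub_exp_hat_le v 0

/-- Along `t v` the derivative of each Taylor remainder is the previous remainder times `hat v`;
this and the next lemma integrate it over `[0, 1]`. The constants are not sharp. -/
theorem norm_exp_hat_sub_one_sub_le (v : Fin 3 → ℝ) :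
    ‖NormedSpace.exp (hat v) - 1 - hat v‖ ≤ l2 v ^ 2 := by
  have hd : ∀ t : ℝ, HasDerivAt (fun t : ℝ => NormedSpace.exp (t • hat v) - t • hat v)
      ((NormedSpace.exp (t • hat v) - 1) * hat v) t := by
    intro t
    refine ((hasDerivAt_exp_smul_hat v t).sub
      ((hasDerivAt_id t).smul_const (hat v))).congr_deriv ?_
    rw [one_smul]; noncomm_ring
  have hb : ∀ t ∈ Icc (0 : ℝ) 1,
      ‖(NormedSpace.exp (t • hat v) - 1) * hat v‖ ≤ l2 v ^ 2 := by
    intro t ht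
    refine (norm_mul_le _ _).trans ?_
    rw [sq, ← hat_smul]
    refine mul_le_mul ((norm_exp_hat_sub_one_le _).trans ?_) (norm_hat_le v) (norm_nonneg _)
      (l2_nonneg v)
    rw [l2_smul_of_nonneg ht.1]
    exact mul_le_of_le_one_left (l2_nonneg v) ht.2
  have := norm_image_sub_le_of_hasDerivAt_le hd hb
  simp only [one_smul, zero_smul, NormedSpace.exp_zero, sub_zero] at this
  rwa [sub_right_comm]

theorem norm_exp_hat_sub_one_sub_sub_le (v : Fin 3 → ℝ) :
    ‖NormedSpace.exp (hat v) - 1 - hat v - (1 / 2 : ℝ) • (hat v * hat v)‖ ≤ l2 v ^ 3 := by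
  have hd : ∀ t : ℝ, HasDerivAt (fun t : ℝ => NormedSpace.exp (t • hat v) - t • hat v -
      (t ^ 2 / 2) • (hat v * hat v)) ((NormedSpace.exp (t • hat v) - 1 - t • hat v) * hat v) t := by
    intro t
    have h3 : HasDerivAt (fun t : ℝ => t ^ 2 / 2) t t := 
      ((hasDerivAt_pow 2 t).div_const 2).congr_deriv (by simp)
    refine (((hasDerivAt_exp_smul_hat v t).sub ((hasDerivAt_id t).smul_const (hat v))).sub
      (h3.smul_const (hat v * hat v))).congr_deriv ?_
    rw [one_smul, sub_mul, sub_mul, one_mul, smul_mul_assoc]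
  have hb : ∀ t ∈ Icc (0 : ℝ) 1,
      ‖(NormedSpace.exp (t • hat v) - 1 - t • hat v) * hat v‖ ≤ l2 v ^ 3 := by
    intro t ht
    refine (norm_mul_le _ _).trans ?_
    rw [pow_succ, ← hat_smul]
    refine mul_le_mul ((norm_exp_hat_sub_one_sub_le _).trans ?_) (norm_hat_le v) (norm_nonneg _)
      (by positivity)
    rw [l2_smul_of_nonneg ht.1]
    have := l2_nonneg v
    exact pow_le_pow_left₀ (mul_nonneg ht.1 this) (mul_le_of_le_one_left this ht.2) 2
  have := norm_image_sub_le_of_hasDerivAt_le hd hb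
  simp only [one_smul, zero_smul, NormedSpace.exp_zero, sub_zero, one_pow, ne_eq, OfNat.ofNat_ne_zero,
    not_false_eq_true, zero_pow, zero_div] at this
  rwa [sub_right_comm _ 1, sub_right_comm _ 1]

end Norms

/-! ### Subalgebras of bounded, Lipschitz and first-order expandable functions. -/

section FunctionAlgebras

variable {X : Type*}

/-- The mean value inequality for `z ↦ f z - z * f' x`, whose derivative is small near `x`. Only a
Lipschitz `f'` is needed. -/
theorem abs_sub_sub_mul_le {f f' : ℝ → ℝ} {s : Set ℝ} (hs : Convex ℝ s) {C : ℝ} (hC : 0 ≤ C)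
    (hf : ∀ x ∈ s, HasDerivWithinAt f (f' x) s x)
    (hf' : ∀ x ∈ s, ∀ y ∈ s, |f' y - f' x| ≤ C * |y - x|) {x y : ℝ} (hx : x ∈ s) (hy : y ∈ s) :
    |f y - f x - (y - x) * f' x| ≤ C * (y - x) ^ 2 := by
  have hsub : uIcc x y ⊆ s := by
    rw [← segment_eq_uIcc]; exact hs.segment_subset hx hy
  have hd : ∀ z ∈ uIcc x y,
      HasDerivWithinAt (fun z => f z - z * f' x) (f' z - f' x) (uIcc x y) z := fun z hz =>
    (((hf z (hsub hz)).mono hsub).sub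
      ((hasDerivWithinAt_id z (uIcc x y)).mul_const (f' x))).congr_deriv (by rw [one_mul])
  have hb : ∀ z ∈ uIcc x y, ‖f' z - f' x‖ ≤ C * |y - x| := fun z hz =>
    (hf' x hx z (hsub hz)).trans
      (mul_le_mul_of_nonneg_left (abs_sub_left_of_mem_uIcc hz) hC)
  have h := (convex_uIcc x y).norm_image_sub_le_of_norm_hasDerivWithin_le hd hb
    left_mem_uIcc right_mem_uIcc
  rw [Real.norm_eq_abs, Real.norm_eq_abs, mul_assoc, abs_mul_abs_self] at h
  convert h using 1
  · congr 1; ring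
  · ring

theorem exists_abs_le_of_continuousOn {φ : ℝ → ℝ} {a b : ℝ} (hφ : ContinuousOn φ (Icc a b)) :
    ∃ C, 0 ≤ C ∧ ∀ x ∈ Icc a b, |φ x| ≤ C := by
  obtain ⟨C, hC⟩ := isCompact_Icc.exists_bound_of_continuousOn hφ
  exact ⟨max C 0, le_max_right _ _, fun x hx => (hC x hx).trans (le_max_left _ _)⟩

theorem exists_abs_sub_le_of_contDiffOn {φ : ℝ → ℝ} {s : Set ℝ} {a b : ℝ}
    (hs : UniqueDiffOn ℝ s) (hab : Icc a b ⊆ s) (hφ : ContDiffOn ℝ 1 φ s) :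
    ∃ C, 0 ≤ C ∧ ∀ x ∈ Icc a b, ∀ y ∈ Icc a b, |φ y - φ x| ≤ C * |y - x| := by
  obtain ⟨C, hC0, hC⟩ := exists_abs_le_of_continuousOn
    ((hφ.continuousOn_derivWithin hs le_rfl).mono hab)
  refine ⟨C, hC0, fun x hx y hy => ?_⟩
  exact (convex_Icc a b).norm_image_sub_le_of_norm_hasDerivWithin_le (fun z hz =>
    (((hφ.differentiableOn one_ne_zero) z (hab hz)).hasDerivWithinAt).mono hab) hC hx hy

theorem exists_abs_sub_sub_le_of_contDiffOn {φ : ℝ → ℝ} {s : Set ℝ} {a b : ℝ}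
    (hs : UniqueDiffOn ℝ s) (hab : Icc a b ⊆ s) (hφ : ContDiffOn ℝ 2 φ s) :
    ∃ C, 0 ≤ C ∧ ∀ x ∈ Icc a b, ∀ y ∈ Icc a b,
      |φ y - φ x - (y - x) * derivWithin φ s x| ≤ C * (y - x) ^ 2 := by
  obtain ⟨C, hC0, hC⟩ := exists_abs_sub_le_of_contDiffOn hs hab
    (hφ.derivWithin (m := 1) hs (by norm_num))
  refine ⟨C, hC0, fun x hx y hy => abs_sub_sub_mul_le (convex_Icc a b) hC0 (fun z hz =>
    (((hφ.differentiableOn two_ne_zero) z (hab hz)).hasDerivWithinAt).mono hab) hC hx hy⟩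

variable (X) in
/-- The algebra of bounded functions. -/
def bddAlg : Subalgebra ℝ (X → ℝ) where
  carrier := {g | ∃ K, ∀ x, |g x| ≤ K}
  mul_mem' := by
    rintro f g ⟨K, hK⟩ ⟨L, hL⟩
    refine ⟨K * L, fun x => ?_⟩
    rw [Pi.mul_apply, abs_mul]
    exact mul_le_mul (hK x) (hL x) (abs_nonneg _) ((abs_nonneg _).trans (hK x))
  add_mem' := by
    rintro f g ⟨K, hK⟩ ⟨L, hL⟩
    exact ⟨K + L, fun x => (abs_add_le _ _).trans (add_le_add (hK x) (hL x))⟩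
  algebraMap_mem' := fun c => ⟨|c|, fun _ => le_rfl⟩

theorem exists_nonneg_bound_of_mem_bddAlg {g : X → ℝ} (hg : g ∈ bddAlg X) :
    ∃ K, 0 ≤ K ∧ ∀ x, |g x| ≤ K := by
  obtain ⟨K, hK⟩ := hg
  exact ⟨max K 0, le_max_right _ _, fun x => (hK x).trans (le_max_left _ _)⟩

/-- The algebra of bounded functions that are Lipschitz for the increment `d` along the
relation `r`. -/
def lipAlg (r : X → X → Prop) (d : X → X → ℝ) : Subalgebra ℝ (X → ℝ) where
  carrier := {g | g ∈ bddAlg X ∧ ∃ K, ∀ x y, r x y → |g y - g x| ≤ K * |d x y|}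
  mul_mem' := by
    rintro f g ⟨hf, K', hK'⟩ ⟨hg, L', hL'⟩
    refine ⟨mul_mem hf hg, ?_⟩
    obtain ⟨K, hK0, hK⟩ := exists_nonneg_bound_of_mem_bddAlg hf
    obtain ⟨L, hL0, hL⟩ := exists_nonneg_bound_of_mem_bddAlg hg
    refine ⟨K * L' + L * K', fun x y h => ?_⟩
    have e : (f * g) y - (f * g) x = f y * (g y - g x) + g x * (f y - f x) := by
      simp only [Pi.mul_apply]; ring
    rw [e]
    refine (abs_add_le _ _).trans ?_
    rw [abs_mul, abs_mul, add_mul, mul_assoc, mul_assoc]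
    exact add_le_add (mul_le_mul (hK y) (hL' x y h) (abs_nonneg _) hK0)
      (mul_le_mul (hL x) (hK' x y h) (abs_nonneg _) hL0)
  add_mem' := by
    rintro f g ⟨hf, K', hK'⟩ ⟨hg, L', hL'⟩
    refine ⟨add_mem hf hg, K' + L', fun x y h => ?_⟩
    have e : (f + g) y - (f + g) x = (f y - f x) + (g y - g x) := by
      simp only [Pi.add_apply]; ring
    rw [e, add_mul]
    exact (abs_add_le _ _).trans (add_le_add (hK' x y h) (hL' x y h))
  algebraMap_mem' := fun c => ⟨algebraMap_mem _ c, 0, fun x y _ => by simp⟩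

theorem exists_nonneg_lipschitz_of_mem_lipAlg {r : X → X → Prop} {d : X → X → ℝ} {g : X → ℝ}
    (hg : g ∈ lipAlg r d) :
    ∃ K, 0 ≤ K ∧ (∀ x, |g x| ≤ K) ∧ ∀ x y, r x y → |g y - g x| ≤ K * |d x y| := by
  obtain ⟨⟨K, hK⟩, L, hL⟩ := hg
  exact ⟨max (max K L) 0, le_max_right _ _,
    fun x => (hK x).trans ((le_max_left _ _).trans (le_max_left _ _)),
    fun x y h => (hL x y h).trans (mul_le_mul_of_nonneg_right
      ((le_max_right _ _).trans (le_max_left _ _)) (abs_nonneg _))⟩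

/-- The algebra of functions with a first-order expansion of quadratic remainder, in the
increment `d` along the relation `r`, whose derivative is bounded and Lipschitz. -/
def taylorAlg (r : X → X → Prop) (d : X → X → ℝ) : Subalgebra ℝ (X → ℝ) where
  carrier := {g | g ∈ lipAlg r d ∧ ∃ g' ∈ lipAlg r d, ∃ K, ∀ x y, r x y →
    |g y - g x - d x y * g' x| ≤ K * d x y ^ 2}
  mul_mem' := by
    rintro f g ⟨hf, f', hf', K', hK'⟩ ⟨hg, g', hg', L', hL'⟩
    refine ⟨mul_mem hf hg, f' * g + f * g', add_mem (mul_mem hf' hg) (mul_mem hf hg'), ?_⟩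
    obtain ⟨K, hK0, hK, hK1⟩ := exists_nonneg_lipschitz_of_mem_lipAlg hf
    obtain ⟨L, hL0, hL, hL1⟩ := exists_nonneg_lipschitz_of_mem_lipAlg hg
    refine ⟨K * L' + L * K' + K * L, fun x y h => ?_⟩
    have e : (f * g) y - (f * g) x - d x y * (f' * g + f * g') x =
        f x * (g y - g x - d x y * g' x) + g x * (f y - f x - d x y * f' x) +
        (f y - f x) * (g y - g x) := by
      simp only [Pi.mul_apply, Pi.add_apply]; ring
    rw [e]
    refine (abs_add_le _ _).trans ?_
    rw [add_mul]
    refine add_le_add ((abs_add_le _ _).trans ?_) ?_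
    · rw [abs_mul, abs_mul, add_mul, mul_assoc, mul_assoc]
      exact add_le_add (mul_le_mul (hK x) (hL' x y h) (abs_nonneg _) hK0)
        (mul_le_mul (hL x) (hK' x y h) (abs_nonneg _) hL0)
    · rw [abs_mul, ← sq_abs (d x y)]
      refine (mul_le_mul (hK1 x y h) (hL1 x y h) (abs_nonneg _) (by positivity)).trans
        (le_of_eq (by ring))
  add_mem' := by
    rintro f g ⟨hf, f', hf', K', hK'⟩ ⟨hg, g', hg', L', hL'⟩
    refine ⟨add_mem hf hg, f' + g', add_mem hf' hg', K' + L', fun x y h => ?_⟩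
    have e : (f + g) y - (f + g) x - d x y * (f' + g') x =
        (f y - f x - d x y * f' x) + (g y - g x - d x y * g' x) := by
      simp only [Pi.add_apply]; ring
    rw [e, add_mul]
    exact (abs_add_le _ _).trans (add_le_add (hK' x y h) (hL' x y h))
  algebraMap_mem' := fun c => ⟨algebraMap_mem _ c, 0, zero_mem _, 0, fun x y _ => by simp⟩

theorem comp_mem_bddAlg {φ : ℝ → ℝ} (hφ : ContinuousOn φ (Ici 0)) {g : X → ℝ}
    (hg : g ∈ bddAlg X) (h0 : ∀ x, 0 ≤ g x) : (fun x => φ (g x)) ∈ bddAlg X := by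
  obtain ⟨B, -, hB⟩ := exists_nonneg_bound_of_mem_bddAlg hg
  obtain ⟨C, -, hC⟩ := exists_abs_le_of_continuousOn (hφ.mono (fun z hz => hz.1 : Icc 0 B ⊆ Ici 0))
  exact ⟨C, fun x => hC _ ⟨h0 x, (le_abs_self _).trans (hB x)⟩⟩

theorem comp_mem_lipAlg {r : X → X → Prop} {d : X → X → ℝ} {φ : ℝ → ℝ}
    (hφ : ContDiffOn ℝ 1 φ (Ici 0)) {g : X → ℝ}
    (hg : g ∈ lipAlg r d) (h0 : ∀ x, 0 ≤ g x) : (fun x => φ (g x)) ∈ lipAlg r d := by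
  obtain ⟨B, -, hB, hB'⟩ := exists_nonneg_lipschitz_of_mem_lipAlg hg
  obtain ⟨C, hC0, hC⟩ := exists_abs_sub_le_of_contDiffOn (uniqueDiffOn_Ici 0)
    (fun z hz => hz.1 : Icc 0 B ⊆ Ici 0) hφ
  have hmem : ∀ x, g x ∈ Icc 0 B := fun x => ⟨h0 x, (le_abs_self _).trans (hB x)⟩
  refine ⟨comp_mem_bddAlg hφ.continuousOn hg.1 h0, C * B, fun x y h => ?_⟩
  rw [mul_assoc]
  exact (hC _ (hmem x) _ (hmem y)).trans (mul_le_mul_of_nonneg_left (hB' x y h) hC0)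

/-- The chain rule: expand `φ` at `g x`, then `g` at `x`. The inner function is bounded, so its
values stay in a compact `[0, B]`, where `φ` has uniform constants. It will be applied to `φ = Φ'`,
which is where `Φ ∈ C³` is needed. -/
theorem comp_mem_taylorAlg {r : X → X → Prop} {d : X → X → ℝ} {φ : ℝ → ℝ}
    (hφ : ContDiffOn ℝ 2 φ (Ici 0)) {g : X → ℝ}
    (hg : g ∈ taylorAlg r d) (h0 : ∀ x, 0 ≤ g x) : (fun x => φ (g x)) ∈ taylorAlg r d := by
  obtain ⟨hgl, g', hg', L, hL⟩ := hg
  obtain ⟨B, hB0, hB, hB'⟩ := exists_nonneg_lipschitz_of_mem_lipAlg hgl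
  obtain ⟨C, hC0, hC⟩ := exists_abs_sub_sub_le_of_contDiffOn (uniqueDiffOn_Ici 0)
    (fun z hz => hz.1 : Icc 0 B ⊆ Ici 0) hφ
  have hmem : ∀ x, g x ∈ Icc 0 B := fun x => ⟨h0 x, (le_abs_self _).trans (hB x)⟩
  have hφ' : (fun x => derivWithin φ (Ici 0) (g x)) ∈ lipAlg r d :=
    comp_mem_lipAlg (hφ.derivWithin (uniqueDiffOn_Ici 0) (by norm_num)) hgl h0
  obtain ⟨P, hP0, hP, -⟩ := exists_nonneg_lipschitz_of_mem_lipAlg hφ'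
  refine ⟨comp_mem_lipAlg (hφ.of_le (by norm_num)) hgl h0, _, mul_mem hφ' hg',
    C * B ^ 2 + P * L, fun x y h => ?_⟩
  have e : φ (g y) - φ (g x) - d x y *
      ((fun x => derivWithin φ (Ici 0) (g x)) * g') x =
      (φ (g y) - φ (g x) - (g y - g x) * derivWithin φ (Ici 0) (g x)) +
      derivWithin φ (Ici 0) (g x) * (g y - g x - d x y * g' x) := by
    simp only [Pi.mul_apply]; ring
  rw [e, add_mul]
  refine (abs_add_le _ _).trans (add_le_add ((hC _ (hmem x) _ (hmem y)).trans ?_) ?_)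
  · rw [mul_assoc, ← sq_abs (d x y), ← mul_pow, ← sq_abs (g y - g x)]
    exact mul_le_mul_of_nonneg_left (pow_le_pow_left₀ (abs_nonneg _) (hB' x y h) 2) hC0
  · rw [abs_mul, mul_assoc]
    exact mul_le_mul (hP x) (hL x y h) (abs_nonneg _) hP0

end FunctionAlgebras

/-! ### Regularity of the forcing term. -/

section Forcing

variable {X : Type*} {n : ℕ}

/-- All entries of a matrix-valued function lie in an algebra of functions. -/
def EntriesMem {k l : Type*} (A : Subalgebra ℝ (X → ℝ)) (M : X → Matrix k l ℝ) : Prop :=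
  ∀ i j, (fun x => M x i j) ∈ A

theorem EntriesMem.mul {k l p : Type*} [Fintype l] {A : Subalgebra ℝ (X → ℝ)}
    {M : X → Matrix k l ℝ} {N : X → Matrix l p ℝ} (hM : EntriesMem A M) (hN : EntriesMem A N) :
    EntriesMem A fun x => M x * N x := by
  intro i j
  have e : (fun x => (M x * N x) i j) = ∑ q, (fun x => M x i q) * fun x => N x q j := by
    ext x; simp [Matrix.mul_apply]
  rw [e]
  exact sum_mem fun q _ => mul_mem (hM i q) (hN q j)

theorem EntriesMem.sub {k l : Type*} {A : Subalgebra ℝ (X → ℝ)}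
    {M N : X → Matrix k l ℝ} (hM : EntriesMem A M) (hN : EntriesMem A N) :
    EntriesMem A fun x => M x - N x :=
  fun i j => sub_mem (hM i j) (hN i j)

theorem EntriesMem.transpose {k l : Type*} {A : Subalgebra ℝ (X → ℝ)}
    {M : X → Matrix k l ℝ} (hM : EntriesMem A M) : EntriesMem A fun x => (M x)ᵀ :=
  fun i j => hM j i

theorem EntriesMem.trace {k : Type*} [Fintype k] {A : Subalgebra ℝ (X → ℝ)}
    {M : X → Matrix k k ℝ} (hM : EntriesMem A M) : (fun x => (M x).trace) ∈ A := by
  have e : (fun x => (M x).trace) = ∑ q, fun x => M x q q := by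
    ext x; simp [Matrix.trace]
  rw [e]
  exact sum_mem fun q _ => hM q q

theorem EntriesMem.mulVec {k l : Type*} [Fintype l] {A : Subalgebra ℝ (X → ℝ)}
    {M : X → Matrix k l ℝ} {v : X → l → ℝ} (hM : EntriesMem A M)
    (hv : ∀ i, (fun x => v x i) ∈ A) (i : k) : (fun x => (M x *ᵥ v x) i) ∈ A := by
  have e : (fun x => (M x *ᵥ v x) i) = ∑ q, (fun x => M x i q) * fun x => v x q := by
    ext x; simp [Matrix.mulVec, dotProduct]
  rw [e]
  exact sum_mem fun q _ => mul_mem (hM i q) (hv q)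

theorem entriesMem_hat {A : Subalgebra ℝ (X → ℝ)} {v : X → Fin 3 → ℝ}
    (hv : ∀ i, (fun x => v x i) ∈ A) : EntriesMem A fun x => hat (v x) := by
  intro i j
  have hn : ∀ i, (fun x => -v x i) ∈ A := fun i => neg_mem (hv i)
  have h0 : (fun _ : X => (0 : ℝ)) ∈ A := zero_mem A
  fin_cases i <;> fin_cases j <;> simp [hat, hv, hn, h0]

/-- The cost is half the trace of `B W Bᵀ` with `B = E - R̂ U`. Nonnegativity keeps the argument of
`Φ'` in `[0, ∞)`, the only place where `Φ` is controlled. -/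
theorem wahba_nonneg {a : Measurement n} (ha : a.W.PosDef) (x : FilterState) : 0 ≤ wahba a x := by
  have h := (ha.posSemidef.mul_mul_conjTranspose_same (a.E - x.rot * a.U)).trace_nonneg
  rw [Matrix.conjTranspose_eq_transpose_of_trivial, Matrix.trace_mul_comm] at h
  exact mul_nonneg (by norm_num) h

/-- The forcing is polynomial in the data and the rotation, apart from the factor `Φ'`. Stated for
an arbitrary subalgebra, this gives its boundedness, its Lipschitz dependence on the rotation, and
its regularity in time. -/
theorem forcing_mem {A : Subalgebra ℝ (X → ℝ)} {Φ : ℝ → ℝ} {a : X → Measurement n}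
    {x : X → FilterState}
    (hE : EntriesMem A fun p => (a p).E) (hU : EntriesMem A fun p => (a p).U)
    (hW : EntriesMem A fun p => (a p).W) (hR : EntriesMem A fun p => (x p).rot)
    (hpos : ∀ p, (a p).W.PosDef)
    (hφ : ∀ g ∈ A, (∀ p, 0 ≤ g p) → (fun p => derivWithin Φ (Ici 0) (g p)) ∈ A) (i : Fin 3) :
    (fun p => forcing Φ (a p) (x p) i) ∈ A := by
  have hw : (fun p => wahba (a p) (x p)) ∈ A := by
    have hB := hE.sub (hR.mul hU)
    exact A.smul_mem (hB.transpose.mul (hB.mul hW)).trace (1 / 2 : ℝ)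
  have hL := (hE.mul hW).mul hU.transpose
  have hS := (hL.transpose.mul hR).sub (hR.transpose.mul hL)
  refine mul_mem (hφ _ hw fun p => wahba_nonneg (hpos p) _)
    (show (fun p => wahbaGrad (a p) (x p) i) ∈ A from ?_)
  fin_cases i
  exacts [hS 2 1, hS 0 2, hS 1 0]

end Forcing

open scoped Matrix.Norms.L2Operator

/-! ### Unique solvability, reversibility and well-posedness. -/

section Solvability

variable {n : ℕ} {Φ : ℝ → ℝ} {m : ℝ} {D : Matrix (Fin 3) (Fin 3) ℝ} {h : ℝ}
  {a b : Measurement n} {x y : FilterState} {F : ℝ}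

theorem smul_one_add_smul_mulVec (c : ℝ) (v : Fin 3 → ℝ) :
    (m • (1 : Matrix (Fin 3) (Fin 3) ℝ) + c • D) *ᵥ v = m • v + c • (D *ᵥ v) := by
  rw [Matrix.add_mulVec, Matrix.smul_mulVec, Matrix.smul_mulVec, Matrix.one_mulVec]

theorem smul_one_sub_smul_mulVec (c : ℝ) (v : Fin 3 → ℝ) :
    (m • (1 : Matrix (Fin 3) (Fin 3) ℝ) - c • D) *ᵥ v = m • v - c • (D *ᵥ v) := by
  rw [Matrix.sub_mulVec, Matrix.smul_mulVec, Matrix.smul_mulVec, Matrix.one_mulVec]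

/-- Take the inner product with `v` and drop the nonnegative damping term. For `h ≥ 0` the constant
`m` is retained in full, so repeated steps do not lose a fixed factor each. -/
theorem mul_l2_le_of_posDef (hD : D.PosDef) (hh : 0 ≤ h) (v : Fin 3 → ℝ) :
    m * l2 v ≤ l2 ((m • (1 : Matrix (Fin 3) (Fin 3) ℝ) + (h / 2) • D) *ᵥ v) := by
  rcases (l2_nonneg v).eq_or_lt with h0 | h0
  · rw [← h0, mul_zero]; exact l2_nonneg _
  · have h1 := dotProduct_le_l2_mul_l2 v
      ((m • (1 : Matrix (Fin 3) (Fin 3) ℝ) + (h / 2) • D) *ᵥ v)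
    have h2 : 0 ≤ v ⬝ᵥ (D *ᵥ v) := by
      simpa using hD.posSemidef.dotProduct_mulVec_nonneg v
    rw [smul_one_add_smul_mulVec] at h1 ⊢
    rw [dotProduct_add, dotProduct_smul, dotProduct_smul, ← l2_sq_eq_dotProduct, smul_eq_mul,
      smul_eq_mul] at h1
    refine le_of_mul_le_mul_left ?_ h0
    have : 0 ≤ h / 2 * (v ⬝ᵥ (D *ᵥ v)) := by positivity
    nlinarith

/-- A perturbation argument valid for both signs of `h`, as reversibility requires; the price is the
factor `1/2`. -/
theorem half_mul_l2_le (hm : 0 < m) (hh : |h| * ‖D‖ ≤ m) (v : Fin 3 → ℝ) :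
    m / 2 * l2 v ≤ l2 ((m • (1 : Matrix (Fin 3) (Fin 3) ℝ) + (h / 2) • D) *ᵥ v) := by
  have e : m • v = (m • (1 : Matrix (Fin 3) (Fin 3) ℝ) + (h / 2) • D) *ᵥ v -
      (h / 2) • (D *ᵥ v) := by rw [smul_one_add_smul_mulVec, add_sub_cancel_right]
  have h1 := congrArg l2 e
  rw [l2_smul_of_nonneg hm.le] at h1
  have h2 := l2_sub_le ((m • (1 : Matrix (Fin 3) (Fin 3) ℝ) + (h / 2) • D) *ᵥ v)
    ((h / 2) • (D *ᵥ v))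
  rw [← h1, l2_smul, abs_div, abs_of_pos (two_pos (α := ℝ))] at h2
  have h3 := mul_le_mul_of_nonneg_left (l2_mulVec_le D v) (abs_nonneg h)
  have h4 := mul_le_mul_of_nonneg_right hh (l2_nonneg v)
  nlinarith

theorem isUnit_of_abs_mul_norm_le (hm : 0 < m) (hh : |h| * ‖D‖ ≤ m) :
    IsUnit (m • (1 : Matrix (Fin 3) (Fin 3) ℝ) + (h / 2) • D) := by
  rw [← Matrix.mulVec_injective_iff_isUnit]
  intro v w hvw
  have h1 := half_mul_l2_le hm hh (v - w)
  rw [Matrix.mulVec_sub, hvw, sub_self, l2_zero] at h1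
  have h2 : l2 (v - w) = 0 := le_antisymm (by nlinarith) (l2_nonneg _)
  exact sub_eq_zero.1 (l2_eq_zero.1 h2)

theorem forcing_congr (hxy : x.rot = y.rot) : forcing Φ a x = forcing Φ a y := by
  simp only [forcing, wahba, wahbaGrad, hxy]

theorem l2_exp_smul_hat_mulVec (c : ℝ) (v w : Fin 3 → ℝ) :
    l2 (NormedSpace.exp (c • hat v) *ᵥ w) = l2 w := by
  rw [← hat_smul, l2_exp_hat_mulVec]

theorem mulVec_midVel (hu : IsUnit (m • (1 : Matrix (Fin 3) (Fin 3) ℝ) + (h / 2) • D)) :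
    (m • (1 : Matrix (Fin 3) (Fin 3) ℝ) + (h / 2) • D) *ᵥ midVel Φ m D h a x =
      NormedSpace.exp (-(h / 2) • hat (estVel a x)) *ᵥ (m • x.ω) + (h / 2) • forcing Φ a x :=
  (eq_midVel_iff hu).1 rfl

theorem l2_mulVec_midVel_le (hm : 0 < m)
    (hu : IsUnit (m • (1 : Matrix (Fin 3) (Fin 3) ℝ) + (h / 2) • D))
    (hF : l2 (forcing Φ a x) ≤ F) :
    l2 ((m • (1 : Matrix (Fin 3) (Fin 3) ℝ) + (h / 2) • D) *ᵥ midVel Φ m D h a x) ≤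
      m * l2 x.ω + |h| / 2 * F := by
  rw [mulVec_midVel hu]
  refine (l2_add_le _ _).trans ?_
  rw [l2_exp_smul_hat_mulVec, l2_smul_of_nonneg hm.le, l2_smul, abs_div,
    abs_of_pos (two_pos (α := ℝ))]
  gcongr

theorem l2_impulse_le (hm : 0 < m) {w f : Fin 3 → ℝ} (hF : l2 f ≤ F) :
    l2 ((m • (1 : Matrix (Fin 3) (Fin 3) ℝ) - (h / 2) • D) *ᵥ w + (h / 2) • f) ≤
      (m + |h| / 2 * ‖D‖) * l2 w + |h| / 2 * F := by
  refine (l2_add_le _ _).trans (add_le_add ?_ ?_)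
  · rw [smul_one_sub_smul_mulVec, add_mul]
    refine (l2_sub_le _ _).trans ?_
    rw [l2_smul_of_nonneg hm.le, l2_smul, abs_div, abs_of_pos (two_pos (α := ℝ)), mul_assoc]
    gcongr
    exact l2_mulVec_le D w
  · rw [l2_smul, abs_div, abs_of_pos (two_pos (α := ℝ))]
    gcongr

theorem mul_l2_ω_eq_of_filter2 (hm : 0 < m) (hxy : filter2 Φ m D h a b x y) :
    m * l2 y.ω = l2 ((m • (1 : Matrix (Fin 3) (Fin 3) ℝ) - (h / 2) • D) *ᵥ midVel Φ m D h a x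
        + (h / 2) • forcing Φ b y) := by
  have := congrArg l2 hxy.2
  rwa [l2_smul_of_nonneg hm.le, l2_exp_smul_hat_mulVec] at this

/-- The midpoint velocity is at most `2 (M + F / m)` and `m I - (h/2) D` has norm at most `2 m`,
giving `4 m M + 4 F`; the new forcing adds at most `F`. -/
theorem l2_impulse_midVel_le (hm : 0 < m) (hh1 : |h| ≤ 1) (hh : |h| * ‖D‖ ≤ m)
    (hFa : l2 (forcing Φ a x) ≤ F) (hFb : l2 (forcing Φ b y) ≤ F) {M : ℝ} (hM : l2 x.ω ≤ M) :
    l2 ((m • (1 : Matrix (Fin 3) (Fin 3) ℝ) - (h / 2) • D) *ᵥ midVel Φ m D h a x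
        + (h / 2) • forcing Φ b y) ≤ 4 * m * M + 5 * F := by
  have hF0 : 0 ≤ F := (l2_nonneg _).trans hFa
  have hw := (half_mul_l2_le hm hh _).trans
    (l2_mulVec_midVel_le hm (isUnit_of_abs_mul_norm_le hm hh) hFa)
  have hV := l2_impulse_le (D := D) (h := h) (w := midVel Φ m D h a x) hm hFb
  have h1 : |h| / 2 * F ≤ F := by nlinarith
  have h2 : m * l2 x.ω ≤ m * M := mul_le_mul_of_nonneg_left hM hm.le
  have h3 := mul_le_mul_of_nonneg_right (show m + |h| / 2 * ‖D‖ ≤ 2 * m by linarith)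
    (l2_nonneg (midVel Φ m D h a x))
  nlinarith

/-- The exponential is `1`-Lipschitz in its generator, so the fixed point map has Lipschitz constant
`|c| * l2 v / m ≤ 1/2` on the whole Euclidean space. Uniqueness therefore holds among all
velocities, not only nearby ones. -/
theorem existsUnique_eq_exp_mulVec (hm : 0 < m) {c : ℝ} (w v : Fin 3 → ℝ)
    (hc : |c| * l2 v ≤ m / 2) :
    ∃ u : Fin 3 → ℝ, ∀ u', m • u' = NormedSpace.exp (-c • hat (w - u')) *ᵥ v ↔ u' = u := by
  let T : EuclideanSpace ℝ (Fin 3) → EuclideanSpace ℝ (Fin 3) := fun u =>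
    WithLp.toLp 2 (m⁻¹ • NormedSpace.exp (-c • hat (w - u.ofLp)) *ᵥ v)
  have hT : ContractingWith (1 / 2) T := by
    refine ⟨by norm_num [← NNReal.coe_lt_coe], LipschitzWith.of_dist_le_mul fun u u' => ?_⟩
    rw [dist_eq_norm, dist_eq_norm]
    have e : T u - T u' = WithLp.toLp 2 (m⁻¹ • ((NormedSpace.exp (hat (-c • (w - u.ofLp))) -
        NormedSpace.exp (hat (-c • (w - u'.ofLp)))) *ᵥ v)) := by
      rw [hat_smul, hat_smul, Matrix.sub_mulVec, smul_sub, WithLp.toLp_sub]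
    rw [e]
    change l2 _ ≤ _ * l2 (u - u').ofLp
    rw [l2_smul_of_nonneg (inv_nonneg.2 hm.le)]
    have h1 := norm_exp_hat_sub_exp_hat_le (-c • (w - u.ofLp)) (-c • (w - u'.ofLp))
    rw [← smul_sub, sub_sub_sub_cancel_left, l2_smul, abs_neg, l2_sub_comm] at h1
    have h2 := (l2_mulVec_le _ v).trans (mul_le_mul_of_nonneg_right h1 (l2_nonneg v))
    rw [inv_mul_le_iff₀ hm]
    refine h2.trans ?_
    have h3 := mul_le_mul_of_nonneg_right hc (l2_nonneg (u.ofLp - u'.ofLp))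
    rw [WithLp.ofLp_sub]
    simp only [NNReal.coe_div, NNReal.coe_one, NNReal.coe_ofNat]
    linarith
  refine ⟨hT.fixedPoint.ofLp, fun u' => ?_⟩
  have key : m • u' = NormedSpace.exp (-c • hat (w - u')) *ᵥ v ↔
      Function.IsFixedPt T (WithLp.toLp 2 u') := by
    simp only [Function.IsFixedPt, T, (WithLp.toLp_injective 2).eq_iff]
    rw [inv_smul_eq_iff₀ hm.ne', eq_comm]
  rw [key]
  constructor
  · intro hu
    rw [← hT.fixedPoint_unique hu]
  · rintro rfl
    exact hT.fixedPoint_isFixedPt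

theorem exists_filter2_iff (hm : 0 < m)
    (hV : ∀ y, |h| * l2 ((m • (1 : Matrix (Fin 3) (Fin 3) ℝ) - (h / 2) • D) *ᵥ midVel Φ m D h a x
        + (h / 2) • forcing Φ b y) ≤ m) :
    ∃ y, ∀ y', filter2 Φ m D h a b x y' ↔ y' = y := by
  set r : Fin 3 → ℝ := h • (midΩ a b - midVel Φ m D h a x)
  obtain ⟨u, hu⟩ := existsUnique_eq_exp_mulVec hm (c := h / 2) b.Ω
    ((m • (1 : Matrix (Fin 3) (Fin 3) ℝ) - (h / 2) • D) *ᵥ midVel Φ m D h a x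
        + (h / 2) • forcing Φ b (x.advance r 0)) (by
      have := hV (x.advance r 0)
      rw [abs_div, abs_of_pos (two_pos (α := ℝ))]; linarith)
  refine ⟨x.advance r u, fun y' => ?_⟩
  rw [filter2, ← hat_smul, ← FilterState.advance_rot x r 0]
  constructor
  · rintro ⟨hR, hω⟩
    rw [forcing_congr hR, estVel, hu] at hω
    exact ext_rot hR hω
  · rintro rfl
    refine ⟨rfl, ?_⟩
    rw [forcing_congr (x := x.advance r u) (y := x.advance r 0) rfl, estVel, hu]
    rfl

theorem exists_filter2_iff_of_l2_le (hm : 0 < m) (hh1 : |h| ≤ 1) (hh : |h| * ‖D‖ ≤ m)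
    (hFa : ∀ x, l2 (forcing Φ a x) ≤ F) (hFb : ∀ x, l2 (forcing Φ b x) ≤ F) {M : ℝ}
    (hM : l2 x.ω ≤ M) (hhM : |h| * (4 * m * M + 5 * F) ≤ m) :
    ∃ y, ∀ y', filter2 Φ m D h a b x y' ↔ y' = y :=
  exists_filter2_iff hm fun _ => (mul_le_mul_of_nonneg_left
    (l2_impulse_midVel_le hm hh1 hh (hFa _) (hFb _) hM) (abs_nonneg h)).trans hhM

/-- The data are continuous on a compact interval, and the state enters only through its rotation,
whose entries are at most `1`; no velocity bound is involved. -/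
theorem exists_forcing_bound (hΦ : ContinuousOn (derivWithin Φ (Ici 0)) (Ici 0))
    {s : ℝ → Measurement n} {t₀ T : ℝ}
    (hW : ∀ t ∈ Icc t₀ T, (s t).W.PosDef) (hs : IsSmoothSignal 0 s t₀ T) :
    ∃ F, ∀ t ∈ Icc t₀ T, ∀ x, l2 (forcing Φ (s t) x) ≤ F := by
  have hc : ∀ f : ℝ → ℝ, ContDiffOn ℝ (0 : ℕ) f (Icc t₀ T) →
      (fun p : Icc t₀ T × FilterState => f p.1) ∈ bddAlg (Icc t₀ T × FilterState) := by
    intro f hf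
    obtain ⟨C, -, hC⟩ := exists_abs_le_of_continuousOn hf.continuousOn
    exact ⟨C, fun p => hC _ p.1.2⟩
  have h := fun i => forcing_mem (A := bddAlg (Icc t₀ T × FilterState)) (Φ := Φ)
    (a := fun p => s p.1) (x := fun p => p.2)
    (fun i j => hc _ (hs.E i j)) (fun i j => hc _ (hs.U i j)) (fun i j => hc _ (hs.W i j))
    (fun i j => ⟨1, fun p => (abs_entry_le_norm _ i j).trans (norm_rot p.2).le⟩)
    (fun p => hW _ p.1.2) (fun g hg h0 => comp_mem_bddAlg hΦ hg h0) i
  choose K hK using h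
  refine ⟨2 * ‖K‖, fun t ht x => l2_le_of_abs_apply_le fun i => (hK i (⟨t, ht⟩, x)).trans ?_⟩
  exact (le_abs_self _).trans (norm_le_pi_norm K i)

theorem exists_pos_step_bound (S : Finset ℝ) (hm : 0 < m) :
    ∃ h₀ > 0, ∀ h : ℝ, |h| ≤ h₀ → |h| ≤ 1 ∧ ∀ K ∈ S, |h| * K ≤ m := by
  set B : ℝ := m + ∑ K ∈ S, |K|
  have hS : 0 ≤ ∑ K ∈ S, |K| := Finset.sum_nonneg fun K _ => abs_nonneg K
  have hB : 0 < B := by positivity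
  refine ⟨m / B, by positivity, fun h hh => ⟨hh.trans ?_, fun K hK => ?_⟩⟩
  · rw [div_le_one hB]; simp only [B]; linarith
  · have h1 : K ≤ B := by
      have := Finset.single_le_sum (f := fun K : ℝ => |K|) (fun K _ => abs_nonneg K) hK
      exact (le_abs_self K).trans (this.trans (by simp only [B]; linarith))
    rw [le_div_iff₀ hB] at hh
    exact (mul_le_mul_of_nonneg_left h1 (abs_nonneg h)).trans hh

theorem isReversibleMap_filter2 (hm : 0 < m) {s : ℝ → Measurement n} {t₀ T : ℝ}
    (hF : ∀ t ∈ Icc t₀ T, ∀ x, l2 (forcing Φ (s t) x) ≤ F) :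
    IsReversibleMap (filter2 Φ m D) s t₀ T := by
  intro M
  set K₁ := 4 * m * (2 * M) + 5 * F
  -- `K₁` controls the impulse of the forward step, so the new velocity is at most `K₁ / m`; `K₂` is
  -- the corresponding bound for the step back from there.
  set K₂ := 4 * m * (K₁ / m) + 5 * F
  obtain ⟨h₀, hh₀, hsmall⟩ := exists_pos_step_bound {‖D‖, K₁, K₂} hm
  refine ⟨h₀, hh₀, fun h hh t ht ht' x hx => ?_⟩
  obtain ⟨h1, hK⟩ := hsmall h hh
  have hhD := hK ‖D‖ (by simp)
  have hx2 : l2 x.ω ≤ 2 * M := (l2_le_norm _).trans (by linarith)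
  obtain ⟨y, hy⟩ := exists_filter2_iff_of_l2_le hm h1 hhD (hF t ht) (hF _ ht') hx2
    (hK K₁ (by simp))
  refine ⟨y, hy, fun w => ?_⟩
  have hxy := (hy y).2 rfl
  have hy2 : l2 y.ω ≤ K₁ / m := by
    rw [le_div_iff₀' hm, mul_l2_ω_eq_of_filter2 hm hxy]
    exact l2_impulse_midVel_le hm h1 hhD (hF t ht x) (hF _ ht' y) hx2
  obtain ⟨z, hz⟩ := exists_filter2_iff_of_l2_le (h := -h) (D := D) hm (by rwa [abs_neg])
    (by rwa [abs_neg]) (hF _ ht') (hF t ht) hy2 (by rw [abs_neg]; exact hK K₂ (by simp))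
  have hu := isUnit_of_abs_mul_norm_le hm hhD
  have hu' : IsUnit (m • (1 : Matrix (Fin 3) (Fin 3) ℝ) - (h / 2) • D) := by
    have := isUnit_of_abs_mul_norm_le (h := -h) hm (by rwa [abs_neg])
    rwa [neg_div, neg_smul, ← sub_eq_add_neg] at this
  -- By symmetry `x` solves the backward step, whose solution is unique.
  rw [hz w, (hz x).1 ((filter2_symm hu hu').2 hxy)]

/-- The inhomogeneity is written as `p * q` so that `u + q` is simply multiplied by at most `1 + p ≤
exp p` per step. -/
theorem discrete_gronwall {N : ℕ} {u : Fin (N + 1) → ℝ} {p q : ℝ} (hp : 0 ≤ p) (hq : 0 ≤ u 0 + q)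
    (hu : ∀ i : Fin N, u i.succ ≤ (1 + p) * u i.castSucc + p * q) (i : Fin (N + 1)) :
    u i + q ≤ Real.exp (p * (i : ℕ)) * (u 0 + q) := by
  have h1 : u i + q ≤ (1 + p) ^ (i : ℕ) * (u 0 + q) := by
    induction i using Fin.induction with
    | zero => simp
    | succ i ih =>
      rw [Fin.val_succ, pow_succ']
      have := mul_le_mul_of_nonneg_left ih (show 0 ≤ 1 + p by linarith)
      rw [Fin.val_castSucc] at this
      nlinarith [hu i]
  refine h1.trans (mul_le_mul_of_nonneg_right ?_ hq)
  rw [mul_comm p, Real.exp_nat_mul]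
  refine pow_le_pow_left₀ (by linarith) ?_ _
  linarith [Real.add_one_le_exp p]

theorem grid_mem {t₀ T : ℝ} {N : ℕ} (hh : 0 < h) (hN : t₀ + N * h ≤ T) {i : ℕ} (hi : i ≤ N) :
    t₀ + i * h ∈ Icc t₀ T := by
  have : (i : ℝ) * h ≤ N * h := mul_le_mul_of_nonneg_right (by exact_mod_cast hi) hh.le
  exact ⟨by nlinarith [(Nat.cast_nonneg i : (0 : ℝ) ≤ i)], by linarith⟩

theorem exp_grid_le {t₀ T L : ℝ} {N : ℕ} (hL : 0 ≤ L) (hh : 0 < h) (hN : t₀ + N * h ≤ T)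
    (i : Fin (N + 1)) : Real.exp (L * h * (i : ℕ)) ≤ Real.exp (L * (T - t₀)) := by
  refine Real.exp_le_exp.2 ?_
  have := (grid_mem hh hN (Nat.lt_succ_iff.1 i.2)).2
  nlinarith

/-- The growth rate of the discrete angular velocity. -/
noncomputable def growth (m F : ℝ) (D : Matrix (Fin 3) (Fin 3) ℝ) : ℝ :=
  ‖D‖ / m + F / m + ‖D‖ / m * (F / m)

theorem growth_nonneg (hm : 0 < m) (hF : 0 ≤ F) : 0 ≤ growth m F D := by
  unfold growth; positivity

theorem l2_midVel_le (hm : 0 < m) (hD : D.PosDef) (hh : 0 ≤ h) (hFa : l2 (forcing Φ a x) ≤ F) :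
    l2 (midVel Φ m D h a x) ≤ l2 x.ω + h / 2 * (F / m) := by
  have hw := (mul_l2_le_of_posDef (m := m) hD hh _).trans
    (l2_mulVec_midVel_le hm (isUnit_smul_one_add_smul hm hD hh) hFa)
  rw [abs_of_nonneg hh] at hw
  rw [← mul_le_mul_iff_right₀ hm]
  refine hw.trans (le_of_eq ?_)
  field_simp

theorem l2_ω_le_of_filter2 (hm : 0 < m) (hD : D.PosDef) (hh : 0 ≤ h) (hh1 : h ≤ 1)
    (hFa : l2 (forcing Φ a x) ≤ F) (hFb : l2 (forcing Φ b y) ≤ F)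
    (hxy : filter2 Φ m D h a b x y) :
    l2 y.ω ≤ (1 + growth m F D * h) * l2 x.ω + growth m F D * h * 1 := by
  have hF0 : 0 ≤ F := (l2_nonneg _).trans hFa
  have hw := l2_midVel_le hm hD hh hFa
  have hy := l2_impulse_le (D := D) (h := h) (w := midVel Φ m D h a x) hm hFb
  rw [← mul_l2_ω_eq_of_filter2 hm hxy, abs_of_nonneg hh] at hy
  have hy' : l2 y.ω ≤ (1 + h / 2 * (‖D‖ / m)) * l2 (midVel Φ m D h a x) + h / 2 * (F / m) := by
    rw [← mul_le_mul_iff_right₀ hm]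
    refine hy.trans (le_of_eq ?_)
    field_simp
  refine hy'.trans ?_
  have hd : 0 ≤ ‖D‖ / m := by positivity
  have hf : 0 ≤ F / m := by positivity
  have h1 := mul_le_mul_of_nonneg_left hw (show 0 ≤ 1 + h / 2 * (‖D‖ / m) by positivity)
  have hx := l2_nonneg x.ω
  unfold growth
  generalize ‖D‖ / m = d at *
  generalize F / m = f at *
  have h2 : 0 ≤ h * f * l2 x.ω := by positivity
  have h3 : 0 ≤ h * (d * f) * l2 x.ω := by positivity
  have h4 : 0 ≤ h * d * l2 x.ω := by positivity
  have h5 : 0 ≤ h * (d * f) * (1 - h) := mul_nonneg (by positivity) (by linarith)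
  have h6 : 0 ≤ h * (d * f) := by positivity
  have h7 : 0 ≤ h * d := by positivity
  nlinarith

/-- The bound depends neither on `h` nor on `N`. It keeps the contraction condition valid, with a
fixed step bound, at every grid point. -/
theorem l2_ω_le_of_isTrajectory (hm : 0 < m) (hD : D.PosDef) {s : ℝ → Measurement n} {t₀ T : ℝ}
    (hF0 : 0 ≤ F) (hF : ∀ t ∈ Icc t₀ T, ∀ x, l2 (forcing Φ (s t) x) ≤ F) (hh : 0 < h) (hh1 : h ≤ 1)
    {N : ℕ} (hN : t₀ + N * h ≤ T) {x : Fin (N + 1) → FilterState}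
    (hx : IsTrajectory (filter2 Φ m D) s t₀ h N x) {M : ℝ} (hM : l2 (x 0).ω ≤ M)
    (i : Fin (N + 1)) :
    l2 (x i).ω ≤ Real.exp (growth m F D * (T - t₀)) * (M + 1) := by
  have hc := growth_nonneg (D := D) hm hF0
  have h0 : 0 ≤ l2 (x 0).ω + 1 := by linarith [l2_nonneg (x 0).ω]
  have h1 := discrete_gronwall (u := fun i => l2 (x i).ω) (p := growth m F D * h) (q := 1)
    (by positivity) h0 (fun i => by
      have hi1 := grid_mem hh hN i.2.le
      have hi2 := grid_mem hh hN (Nat.succ_le_of_lt i.2)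
      rw [Nat.cast_succ] at hi2
      exact l2_ω_le_of_filter2 hm hD hh.le hh1 (hF _ hi1 _) (hF _ hi2 _) (hx i)) i
  have h2 := mul_le_mul (exp_grid_le hc hh hN i) (show l2 (x 0).ω + 1 ≤ M + 1 by linarith)
    h0 (Real.exp_pos _).le
  exact (le_add_of_nonneg_right zero_le_one).trans (h1.trans h2)

theorem isWellPosed_filter2 (hm : 0 < m) (hD : D.PosDef) {s : ℝ → Measurement n} {t₀ T : ℝ}
    (hF0 : 0 ≤ F) (hF : ∀ t ∈ Icc t₀ T, ∀ x, l2 (forcing Φ (s t) x) ≤ F) :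
    IsWellPosed (filter2 Φ m D) s t₀ T := by
  intro M
  set B := Real.exp (growth m F D * (T - t₀)) * (2 * M + 1)
  obtain ⟨h₀, hh₀, hsmall⟩ := exists_pos_step_bound {‖D‖, 4 * m * B + 5 * F} hm
  refine ⟨h₀, hh₀, fun h hpos hh N hN x₀ hx₀ => ?_⟩
  obtain ⟨h1, hK⟩ := hsmall h (by rwa [abs_of_pos hpos])
  have hstep : ∀ t ∈ Icc t₀ T, ∀ t' ∈ Icc t₀ T, ∀ x : FilterState, l2 x.ω ≤ B →
      ∃ y, ∀ y', filter2 Φ m D h (s t) (s t') x y' ↔ y' = y := fun t ht t' ht' x hx =>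
    exists_filter2_iff_of_l2_le hm h1 (hK _ (by simp)) (hF t ht) (hF t' ht') hx (hK _ (by simp))
  have hx2 : l2 x₀.ω ≤ 2 * M := (l2_le_norm _).trans (by linarith)
  have hbound : ∀ N : ℕ, t₀ + N * h ≤ T → ∀ x : Fin (N + 1) → FilterState, x 0 = x₀ →
      IsTrajectory (filter2 Φ m D) s t₀ h N x → ∀ i, l2 (x i).ω ≤ B := fun N hN x h0 hx i =>
    l2_ω_le_of_isTrajectory hm hD hF0 hF hpos ((le_abs_self h).trans h1) hN hx (h0 ▸ hx2) i
  -- Existence extends a trajectory by one state; the a priori bound for the shorter trajectory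
  -- guarantees that its last state admits another step.
  have hex : ∀ N : ℕ, t₀ + N * h ≤ T → ∃ x : Fin (N + 1) → FilterState, x 0 = x₀ ∧
      IsTrajectory (filter2 Φ m D) s t₀ h N x := by
    intro N
    induction N with
    | zero => exact fun _ => ⟨fun _ => x₀, rfl, fun i => i.elim0⟩
    | succ N ih =>
      intro hN
      have hN' : t₀ + N * h ≤ T := (grid_mem hpos hN N.le_succ).2
      obtain ⟨x, h0, hx⟩ := ih hN'
      have hN2 := grid_mem hpos hN le_rfl
      rw [Nat.cast_succ] at hN2
      obtain ⟨y, hy⟩ := hstep _ (grid_mem hpos hN N.le_succ) _ hN2 (x (Fin.last N))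
        (hbound N hN' x h0 hx _)
      refine ⟨Fin.snoc x y, ?_, fun i => ?_⟩
      · rw [← Fin.castSucc_zero, Fin.snoc_castSucc, h0]
      · induction i using Fin.lastCases with
        | last =>
          rw [Fin.snoc_castSucc, Fin.succ_last, Fin.snoc_last, Fin.val_last, hy]
        | cast i =>
          rw [Fin.snoc_castSucc, Fin.succ_castSucc, Fin.snoc_castSucc, Fin.val_castSucc]
          exact hx i
  obtain ⟨x, h0, hx⟩ := hex N hN
  refine ⟨x, ⟨h0, hx⟩, ?_⟩
  rintro x' ⟨h0', hx'⟩
  funext i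
  induction i using Fin.induction with
  | zero => rw [h0, h0']
  | succ i ih =>
    have hi2 := grid_mem hpos hN (Nat.succ_le_of_lt i.2)
    rw [Nat.cast_succ] at hi2
    obtain ⟨y, hy⟩ := hstep _ (grid_mem hpos hN i.2.le) _ hi2 (x i.castSucc)
      (hbound N hN x h0 hx _)
    have e1 := hx' i
    rw [ih] at e1
    rw [(hy _).1 e1, (hy _).1 (hx i)]

end Solvability

/-! ### Exact solutions: energy bound, expansions in time, trapezoidal rule. -/

section ExactSolutions

variable {n : ℕ} {Φ : ℝ → ℝ} {m : ℝ} {D : Matrix (Fin 3) (Fin 3) ℝ} {s : ℝ → Measurement n}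
  {t₀ T B F : ℝ}

/-- The right-hand side of the equation for `ω'`. -/
noncomputable def accel (Φ : ℝ → ℝ) (m : ℝ) (D : Matrix (Fin 3) (Fin 3) ℝ) (a : Measurement n)
    (x : FilterState) : Fin 3 → ℝ :=
  m⁻¹ • (-(m • (hat (estVel a x) *ᵥ x.ω)) + forcing Φ a x - D *ᵥ x.ω)

theorem smul_accel (hm : 0 < m) (a : Measurement n) (x : FilterState) :
    m • accel Φ m D a x = -(m • (hat (estVel a x) *ᵥ x.ω)) + forcing Φ a x - D *ᵥ x.ω :=
  smul_inv_smul₀ hm.ne' _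

theorem IsFilterSolution.hasDerivWithinAt_ω (hm : 0 < m) {a b : ℝ} {x : ℝ → FilterState}
    (hx : IsFilterSolution Φ m D s a b x) {t : ℝ} (ht : t ∈ Icc a b) (i : Fin 3) :
    HasDerivWithinAt (fun τ => (x τ).ω i) (accel Φ m D (s t) (x t) i) (Icc a b) t := by
  have h := (hasDerivWithinAt_pi.1 ((hx t ht).2.const_smul m⁻¹)) i
  simpa [accel, inv_smul_smul₀ hm.ne', hat_mulVec, hm.ne'] using h

theorem IsFilterSolution.mono {a b a' b' : ℝ} {x : ℝ → FilterState}
    (hx : IsFilterSolution Φ m D s a b x) (h : Icc a' b' ⊆ Icc a b) :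
    IsFilterSolution Φ m D s a' b' x := fun t ht =>
  ⟨fun i j => ((hx t (h ht)).1 i j).mono h, (hx t (h ht)).2.mono h⟩

/-- The gyroscopic term is orthogonal to `ω` and the damping dissipates, so only the forcing can
feed the energy; Young's inequality bounds its contribution. -/
theorem dotProduct_accel_le (hm : 0 < m) (hD : D.PosDef) {a : Measurement n} {x : FilterState}
    (hF : l2 (forcing Φ a x) ≤ F) :
    2 * (x.ω ⬝ᵥ accel Φ m D a x) ≤ m⁻¹ * (l2 x.ω ^ 2 + F ^ 2) := by
  have h0 : x.ω ⬝ᵥ (hat (estVel a x) *ᵥ x.ω) = 0 := by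
    rw [hat_mulVec]; exact dot_cross_self _ _
  have h1 : 0 ≤ x.ω ⬝ᵥ (D *ᵥ x.ω) := by
    simpa using hD.posSemidef.dotProduct_mulVec_nonneg x.ω
  have h2 := dotProduct_le_l2_mul_l2 x.ω (forcing Φ a x)
  have h3 := mul_le_mul_of_nonneg_left hF (l2_nonneg x.ω)
  rw [accel, dotProduct_smul, dotProduct_sub, dotProduct_add, dotProduct_neg, dotProduct_smul, h0,
    smul_eq_mul, mul_left_comm]
  refine mul_le_mul_of_nonneg_left ?_ (inv_nonneg.2 hm.le)
  rw [smul_zero]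
  nlinarith [sq_nonneg (l2 x.ω - F)]

/-- Gronwall's inequality with the integrating factor `exp (-(t - a) / m)`: the function `g` is
nonincreasing by the energy estimate. -/
theorem IsFilterSolution.l2_ω_sq_le (hm : 0 < m) (hD : D.PosDef) {a b : ℝ} {x : ℝ → FilterState}
    (hx : IsFilterSolution Φ m D s a b x) (hF : ∀ t ∈ Icc a b, ∀ x, l2 (forcing Φ (s t) x) ≤ F)
    {t : ℝ} (ht : t ∈ Icc a b) :
    l2 (x t).ω ^ 2 ≤ Real.exp (m⁻¹ * (t - a)) * (l2 (x a).ω ^ 2 + F ^ 2) := by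
  set g : ℝ → ℝ := fun t => Real.exp (-(m⁻¹ * (t - a))) * (l2 (x t).ω ^ 2 + F ^ 2)
  have hd : ∀ t ∈ Icc a b, HasDerivWithinAt g
      (Real.exp (-(m⁻¹ * (t - a))) * (2 * ((x t).ω ⬝ᵥ accel Φ m D (s t) (x t)) -
        m⁻¹ * (l2 (x t).ω ^ 2 + F ^ 2))) (Icc a b) t := by
    intro t ht
    have h1 := fun i => hx.hasDerivWithinAt_ω hm ht i
    have h2 : HasDerivWithinAt (fun t => l2 (x t).ω ^ 2 + F ^ 2)
        (2 * ((x t).ω ⬝ᵥ accel Φ m D (s t) (x t))) (Icc a b) t := by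
      simp only [l2_sq]
      refine (((((h1 0).pow 2).add ((h1 1).pow 2)).add ((h1 2).pow 2)).add_const _).congr_deriv ?_
      simp only [dotProduct, Fin.sum_univ_three]
      ring
    have h3 : HasDerivWithinAt (fun t => Real.exp (-(m⁻¹ * (t - a))))
        (Real.exp (-(m⁻¹ * (t - a))) * -m⁻¹) (Icc a b) t := by
      have := ((((hasDerivAt_id t).sub_const a).const_mul m⁻¹).neg).exp
      simpa using this.hasDerivWithinAt
    refine (h3.mul h2).congr_deriv ?_
    ring
  have hanti : AntitoneOn g (Icc a b) := by
    refine antitoneOn_of_hasDerivWithinAt_nonpos (convex_Icc a b)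
      (fun t ht => (hd t ht).continuousWithinAt)
      (fun t ht => (hd t (interior_subset ht)).mono interior_subset) fun t ht => ?_
    have := dotProduct_accel_le hm hD (hF t (interior_subset ht) (x t))
    exact mul_nonpos_of_nonneg_of_nonpos (Real.exp_pos _).le (by linarith)
  have ha : a ∈ Icc a b := ⟨le_rfl, ht.1.trans ht.2⟩
  have h := hanti ha ht ht.1
  simp only [g, sub_self, mul_zero, neg_zero, Real.exp_zero, one_mul] at h
  rw [Real.exp_neg, inv_mul_le_iff₀ (Real.exp_pos _)] at h
  nlinarith [sq_nonneg F]

theorem exists_l2_ω_bound (hm : 0 < m) (hD : D.PosDef)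
    (hF : ∀ t ∈ Icc t₀ T, ∀ x, l2 (forcing Φ (s t) x) ≤ F) (M : ℝ) :
    ∃ B, ∀ a b, t₀ ≤ a → b ≤ T → ∀ x, IsFilterSolution Φ m D s a b x → ‖(x a).ω‖ ≤ M →
      ∀ t ∈ Icc a b, l2 (x t).ω ≤ B := by
  refine ⟨Real.exp (m⁻¹ * (T - t₀)) * ((2 * M) ^ 2 + F ^ 2) + 1, fun a b ha hb x hx hM t ht => ?_⟩
  have h1 := hx.l2_ω_sq_le hm hD (fun t ht => hF t ⟨ha.trans ht.1, ht.2.trans hb⟩) ht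
  have h2 : l2 (x a).ω ^ 2 ≤ (2 * M) ^ 2 :=
    pow_le_pow_left₀ (l2_nonneg _) ((l2_le_norm _).trans (by linarith)) 2
  have h3 : Real.exp (m⁻¹ * (t - a)) ≤ Real.exp (m⁻¹ * (T - t₀)) :=
    Real.exp_le_exp.2 (mul_le_mul_of_nonneg_left (by linarith [ht.2]) (inv_nonneg.2 hm.le))
  have h4 := h1.trans (mul_le_mul h3 (add_le_add_left h2 (F ^ 2)) (by positivity)
    (Real.exp_pos _).le)
  nlinarith [sq_nonneg (l2 (x t).ω - 1)]

/-- A point in time on an exact solution, on a subinterval of `[t₀, T]`, with angular velocity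
bounded by `B`. -/
structure SolutionPoint (Φ : ℝ → ℝ) (m : ℝ) (D : Matrix (Fin 3) (Fin 3) ℝ)
    (s : ℝ → Measurement n) (t₀ T B : ℝ) where
  a : ℝ
  b : ℝ
  τ : ℝ
  x : ℝ → FilterState
  le_a : t₀ ≤ a
  b_le : b ≤ T
  mem : τ ∈ Icc a b
  sol : IsFilterSolution Φ m D s a b x
  bound : ∀ t ∈ Icc a b, l2 (x t).ω ≤ B

namespace SolutionPoint

/-- Two points lie on the same solution. -/
def rel (p q : SolutionPoint Φ m D s t₀ T B) : Prop := p.a = q.a ∧ p.b = q.b ∧ p.x = q.x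

/-- The time increment. -/
def inc (p q : SolutionPoint Φ m D s t₀ T B) : ℝ := q.τ - p.τ

/-- The same solution at another time. -/
def move (p : SolutionPoint Φ m D s t₀ T B) (σ : ℝ) (hσ : σ ∈ Icc p.a p.b) :
    SolutionPoint Φ m D s t₀ T B :=
  { p with τ := σ, mem := hσ }

theorem mem_Icc (p : SolutionPoint Φ m D s t₀ T B) : p.τ ∈ Icc t₀ T :=
  ⟨p.le_a.trans p.mem.1, p.mem.2.trans p.b_le⟩

/-- The data at the given time. -/
def data (p : SolutionPoint Φ m D s t₀ T B) : Measurement n := s p.τ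

/-- The state at the given time. -/
def state (p : SolutionPoint Φ m D s t₀ T B) : FilterState := p.x p.τ

open Classical in
/-- A function of the points of one solution as a function of time. -/
noncomputable def along (g : SolutionPoint Φ m D s t₀ T B → ℝ) (p : SolutionPoint Φ m D s t₀ T B)
    (σ : ℝ) : ℝ :=
  -- The value `0` outside the solution interval is never used.
  if h : σ ∈ Icc p.a p.b then g (p.move σ h) else 0

theorem along_of_rel (g : SolutionPoint Φ m D s t₀ T B → ℝ) {p q : SolutionPoint Φ m D s t₀ T B}
    (h : rel p q) : along g p q.τ = g q := by
  obtain ⟨a, b, τ, x, _, _, _, _, _⟩ := p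
  obtain ⟨a', b', τ', x', _, _, hq, _, _⟩ := q
  obtain ⟨h1, h2, h3⟩ := h
  simp only at h1 h2 h3
  subst h1 h2 h3
  rw [along, dif_pos hq]
  rfl

/-- `g` is the derivative of `U` along all solutions. -/
def IsDeriv (U : (ℝ → FilterState) → ℝ → ℝ) (g : SolutionPoint Φ m D s t₀ T B → ℝ) : Prop :=
  ∀ p : SolutionPoint Φ m D s t₀ T B, HasDerivWithinAt (U p.x) (g p) (Icc p.a p.b) p.τ

variable {U : (ℝ → FilterState) → ℝ → ℝ} {g : SolutionPoint Φ m D s t₀ T B → ℝ}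

theorem IsDeriv.along (h : IsDeriv U g) (p : SolutionPoint Φ m D s t₀ T B) {σ : ℝ}
    (hσ : σ ∈ Icc p.a p.b) : HasDerivWithinAt (U p.x) (along g p σ) (Icc p.a p.b) σ := by
  have := h (p.move σ hσ)
  rwa [← along_of_rel g (p := p) (q := p.move σ hσ) ⟨rfl, rfl, rfl⟩] at this

theorem IsDeriv.mem_lipAlg (h : IsDeriv U g) (hg : g ∈ bddAlg (SolutionPoint Φ m D s t₀ T B))
    (hU : (fun p : SolutionPoint Φ m D s t₀ T B => U p.x p.τ) ∈ bddAlg _) :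
    (fun p : SolutionPoint Φ m D s t₀ T B => U p.x p.τ) ∈ lipAlg rel inc := by
  obtain ⟨K, hK⟩ := hg
  refine ⟨hU, K, fun p q hpq => ?_⟩
  have hb : ∀ σ ∈ Icc p.a p.b, ‖SolutionPoint.along g p σ‖ ≤ K := fun σ hσ => by
    have := hK (p.move σ hσ)
    rwa [← along_of_rel g (p := p) (q := p.move σ hσ) ⟨rfl, rfl, rfl⟩] at this
  have hq : q.τ ∈ Icc p.a p.b := by rw [hpq.1, hpq.2.1]; exact q.mem
  have := (convex_Icc p.a p.b).norm_image_sub_le_of_norm_hasDerivWithin_le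
    (fun σ hσ => h.along p hσ) hb p.mem hq
  change |U q.x q.τ - U p.x p.τ| ≤ _
  rw [← hpq.2.2]
  exact this

theorem IsDeriv.exists_abs_sub_sub_le (h : IsDeriv U g) (hg : g ∈ lipAlg rel inc) :
    ∃ K, ∀ p q : SolutionPoint Φ m D s t₀ T B, rel p q →
      |U q.x q.τ - U p.x p.τ - inc p q * g p| ≤ K * inc p q ^ 2 := by
  obtain ⟨K, hK0, -, hK⟩ := exists_nonneg_lipschitz_of_mem_lipAlg hg
  refine ⟨K, fun p q hpq => ?_⟩
  have hb : ∀ σ ∈ Icc p.a p.b, ∀ σ' ∈ Icc p.a p.b,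
      |SolutionPoint.along g p σ' - SolutionPoint.along g p σ| ≤ K * |σ' - σ| := by
    intro σ hσ σ' hσ'
    have := hK (p.move σ hσ) (p.move σ' hσ') ⟨rfl, rfl, rfl⟩
    rwa [← along_of_rel g (p := p) (q := p.move σ hσ) ⟨rfl, rfl, rfl⟩,
      ← along_of_rel g (p := p) (q := p.move σ' hσ') ⟨rfl, rfl, rfl⟩] at this
  have hq : q.τ ∈ Icc p.a p.b := by rw [hpq.1, hpq.2.1]; exact q.mem
  have := abs_sub_sub_mul_le (convex_Icc p.a p.b) hK0 (fun σ hσ => h.along p hσ) hb p.mem hq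
  rw [along_of_rel g (p := p) (q := p) ⟨rfl, rfl, rfl⟩] at this
  rw [← hpq.2.2]
  exact this

/-- The second rung of the bootstrap: a Lipschitz derivative supplies the expansion of `U`. The
constants are uniform over all solutions because points of all of them form one type. -/
theorem IsDeriv.mem_taylorAlg (h : IsDeriv U g) (hg : g ∈ lipAlg rel inc)
    (hU : (fun p : SolutionPoint Φ m D s t₀ T B => U p.x p.τ) ∈ bddAlg _) :
    (fun p : SolutionPoint Φ m D s t₀ T B => U p.x p.τ) ∈ taylorAlg rel inc :=
  ⟨h.mem_lipAlg hg.1 hU, g, hg, h.exists_abs_sub_sub_le hg⟩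

/-- The error of the trapezoidal rule. -/
theorem IsDeriv.exists_trapezoid_le (h : IsDeriv U g) (hg : g ∈ taylorAlg rel inc) :
    ∃ K, ∀ p q : SolutionPoint Φ m D s t₀ T B, rel p q →
      |U q.x q.τ - U p.x p.τ - inc p q / 2 * (g p + g q)| ≤ K * |inc p q| ^ 3 := by
  obtain ⟨-, g', -, K', hK'⟩ := hg
  obtain ⟨K, hK1, hK⟩ : ∃ K, 0 ≤ K ∧ ∀ p q : SolutionPoint Φ m D s t₀ T B, rel p q →
      |g q - g p - inc p q * g' p| ≤ K * inc p q ^ 2 :=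
    ⟨|K'|, abs_nonneg _, fun p q h => (hK' p q h).trans
      (mul_le_mul_of_nonneg_right (le_abs_self K') (sq_nonneg _))⟩
  refine ⟨K + K / 2, fun p q hpq => ?_⟩
  have hq : q.τ ∈ Icc p.a p.b := by rw [hpq.1, hpq.2.1]; exact q.mem
  have hsub : uIcc p.τ q.τ ⊆ Icc p.a p.b := by
    rw [← segment_eq_uIcc]; exact (convex_Icc p.a p.b).segment_subset p.mem hq
  have hd : ∀ σ ∈ uIcc p.τ q.τ, HasDerivWithinAt
      (fun σ => U p.x σ - (σ * g p + (σ - p.τ) ^ 2 / 2 * g' p))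
      (SolutionPoint.along g p σ - g p - (σ - p.τ) * g' p) (uIcc p.τ q.τ) σ := by
    intro σ hσ
    have h1 : HasDerivWithinAt (fun σ => σ * g p + (σ - p.τ) ^ 2 / 2 * g' p)
        (g p + (σ - p.τ) * g' p) (uIcc p.τ q.τ) σ := by
      have h2 := ((((hasDerivAt_id σ).sub_const p.τ).pow 2).div_const 2).mul_const (g' p)
      refine ((((hasDerivAt_id σ).mul_const (g p)).add h2).congr_deriv ?_).hasDerivWithinAt
      simp
    exact (((h.along p (hsub hσ)).mono hsub).sub h1).congr_deriv (by ring)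
  have hb : ∀ σ ∈ uIcc p.τ q.τ,
      ‖SolutionPoint.along g p σ - g p - (σ - p.τ) * g' p‖ ≤ K * inc p q ^ 2 := by
    intro σ hσ
    have h1 := hK p (p.move σ (hsub hσ)) ⟨rfl, rfl, rfl⟩
    rw [← along_of_rel g (p := p) (q := p.move σ (hsub hσ)) ⟨rfl, rfl, rfl⟩] at h1
    have h3 : |σ - p.τ| ≤ |q.τ - p.τ| := abs_sub_left_of_mem_uIcc hσ
    have h4 : (σ - p.τ) ^ 2 ≤ (q.τ - p.τ) ^ 2 := sq_le_sq.2 h3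
    exact h1.trans (mul_le_mul_of_nonneg_left h4 hK1)
  have h1 := (convex_uIcc p.τ q.τ).norm_image_sub_le_of_norm_hasDerivWithin_le hd hb
    left_mem_uIcc right_mem_uIcc
  have h2 := mul_le_mul_of_nonneg_left (hK p q hpq) (abs_nonneg (inc p q / 2))
  rw [← abs_mul] at h2
  rw [Real.norm_eq_abs, Real.norm_eq_abs] at h1
  -- Subtract the quadratic Taylor polynomial at `p`, then replace its second-order part using the
  -- expansion of `g` at `q`. The errors contribute `K` and `K / 2`. No third derivative of `U` is
  -- required.
  have e : U q.x q.τ - U p.x p.τ - inc p q / 2 * (g p + g q) =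
      (U p.x q.τ - (q.τ * g p + (q.τ - p.τ) ^ 2 / 2 * g' p) -
        (U p.x p.τ - (p.τ * g p + (p.τ - p.τ) ^ 2 / 2 * g' p))) -
      inc p q / 2 * (g q - g p - inc p q * g' p) := by
    rw [← hpq.2.2, inc]; ring
  rw [e]
  refine (abs_sub _ _).trans ((add_le_add h1 h2).trans (le_of_eq ?_))
  rw [abs_div, abs_of_pos (two_pos (α := ℝ)), ← sq_abs (inc p q)]
  change K * |inc p q| ^ 2 * |inc p q| + _ = _
  ring

end SolutionPoint

end ExactSolutions

/-! ### Uniform estimates for exact solutions by bootstrapping. -/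

section Regularity

theorem exists_l2_le {Y : Type*} {S : Set Y} {v : Y → Fin 3 → ℝ} {c : Y → ℝ}
    (hc : ∀ y ∈ S, 0 ≤ c y) (h : ∀ i, ∃ K, ∀ y ∈ S, |v y i| ≤ K * c y) :
    ∃ K, 0 ≤ K ∧ ∀ y ∈ S, l2 (v y) ≤ K * c y := by
  choose K hK using h
  refine ⟨2 * ‖K‖, by positivity, fun y hy => ?_⟩
  rw [mul_assoc]
  exact l2_le_of_abs_apply_le fun i => (hK i y hy).trans
    (mul_le_mul_of_nonneg_right ((le_abs_self _).trans (norm_le_pi_norm K i)) (hc y hy))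

theorem exists_norm_le {Y : Type*} {S : Set Y} {A : Y → Matrix (Fin 3) (Fin 3) ℝ} {c : Y → ℝ}
    (hc : ∀ y ∈ S, 0 ≤ c y) (h : ∀ i j, ∃ K, ∀ y ∈ S, |A y i j| ≤ K * c y) :
    ∃ K, 0 ≤ K ∧ ∀ y ∈ S, ‖A y‖ ≤ K * c y := by
  choose K hK using h
  refine ⟨6 * ∑ i, ∑ j, |K i j|, by positivity, fun y hy => ?_⟩
  rw [mul_assoc]
  refine norm_le_of_abs_entry_le fun i j => (hK i j y hy).trans
    (mul_le_mul_of_nonneg_right ?_ (hc y hy))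
  calc K i j ≤ |K i j| := le_abs_self _
    _ ≤ ∑ j, |K i j| :=
      Finset.single_le_sum (f := fun j => |K i j|) (fun _ _ => abs_nonneg _) (Finset.mem_univ j)
    _ ≤ ∑ i, ∑ j, |K i j| := Finset.single_le_sum (f := fun i => ∑ j, |K i j|)
      (fun _ _ => Finset.sum_nonneg fun _ _ => abs_nonneg _) (Finset.mem_univ i)

variable {n : ℕ} {Φ : ℝ → ℝ} {m : ℝ} {D : Matrix (Fin 3) (Fin 3) ℝ} {s : ℝ → Measurement n}
  {t₀ T B F : ℝ}

theorem accel_mem {X : Type*} {A : Subalgebra ℝ (X → ℝ)} {a : X → Measurement n}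
    {x : X → FilterState} (hΩ : ∀ i, (fun p => (a p).Ω i) ∈ A)
    (hE : EntriesMem A fun p => (a p).E) (hU : EntriesMem A fun p => (a p).U)
    (hW : EntriesMem A fun p => (a p).W) (hR : EntriesMem A fun p => (x p).rot)
    (hω : ∀ i, (fun p => (x p).ω i) ∈ A) (hpos : ∀ p, (a p).W.PosDef)
    (hφ : ∀ g ∈ A, (∀ p, 0 ≤ g p) → (fun p => derivWithin Φ (Ici 0) (g p)) ∈ A) (i : Fin 3) :
    (fun p => accel Φ m D (a p) (x p) i) ∈ A := by
  have hv : EntriesMem A fun p => hat (estVel (a p) (x p)) :=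
    entriesMem_hat fun i => sub_mem (hΩ i) (hω i)
  have hD : EntriesMem A fun _ : X => D := fun i j => algebraMap_mem A (D i j)
  exact A.smul_mem (sub_mem (add_mem (neg_mem (A.smul_mem (hv.mulVec hω i) m))
    (forcing_mem hE hU hW hR hpos hφ i)) (hD.mulVec hω i)) m⁻¹

namespace SolutionPoint

theorem time_mem_taylorAlg (hT : t₀ < T) {f : ℝ → ℝ} (hf : ContDiffOn ℝ 2 f (Icc t₀ T)) :
    (fun p : SolutionPoint Φ m D s t₀ T B => f p.τ) ∈ taylorAlg rel inc := by
  have hu := uniqueDiffOn_Icc hT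
  have hl : ∀ g : ℝ → ℝ, ContDiffOn ℝ 1 g (Icc t₀ T) →
      (fun p : SolutionPoint Φ m D s t₀ T B => g p.τ) ∈ lipAlg rel inc := by
    intro g hg
    obtain ⟨K, -, hK⟩ := exists_abs_le_of_continuousOn hg.continuousOn
    obtain ⟨L, -, hL⟩ := exists_abs_sub_le_of_contDiffOn hu subset_rfl hg
    exact ⟨⟨K, fun p => hK _ p.mem_Icc⟩, L, fun p q _ => hL _ p.mem_Icc _ q.mem_Icc⟩
  obtain ⟨K, -, hK⟩ := exists_abs_sub_sub_le_of_contDiffOn hu subset_rfl hf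
  exact ⟨hl f (hf.of_le (by norm_num)), _, hl _ (hf.derivWithin (m := 1) hu (by norm_num)), K,
    fun p q _ => hK _ p.mem_Icc _ q.mem_Icc⟩

/-- The uniform bounds on exact solutions used in the error analysis. -/
structure Estimates (Φ : ℝ → ℝ) (m : ℝ) (D : Matrix (Fin 3) (Fin 3) ℝ)
    (s : ℝ → Measurement n) (t₀ T B K : ℝ) : Prop where
  nonneg : 0 ≤ K
  vel : ∀ p : SolutionPoint Φ m D s t₀ T B, l2 (estVel p.data p.state) ≤ K
  acc : ∀ p : SolutionPoint Φ m D s t₀ T B, l2 (accel Φ m D p.data p.state) ≤ K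
  vel_sub : ∀ p q : SolutionPoint Φ m D s t₀ T B, rel p q →
    l2 (estVel q.data q.state - estVel p.data p.state) ≤ K * |inc p q|
  ω_sub : ∀ p q : SolutionPoint Φ m D s t₀ T B, rel p q →
    l2 (q.state.ω - p.state.ω) ≤ K * |inc p q|
  rot_sub : ∀ p q : SolutionPoint Φ m D s t₀ T B, rel p q →
    ‖q.state.rot - p.state.rot‖ ≤ K * |inc p q|
  ω_taylor : ∀ p q : SolutionPoint Φ m D s t₀ T B, rel p q →
    l2 (q.state.ω - p.state.ω - inc p q • accel Φ m D p.data p.state) ≤ K * |inc p q| ^ 2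
  ω_trapezoid : ∀ p q : SolutionPoint Φ m D s t₀ T B, rel p q →
    l2 (q.state.ω - p.state.ω - (inc p q / 2) • (accel Φ m D p.data p.state +
      accel Φ m D q.data q.state)) ≤ K * |inc p q| ^ 3
  rot_trapezoid : ∀ p q : SolutionPoint Φ m D s t₀ T B, rel p q →
    ‖q.state.rot - p.state.rot - (inc p q / 2) • (p.state.rot * hat (estVel p.data p.state) +
      q.state.rot * hat (estVel q.data q.state))‖ ≤ K * |inc p q| ^ 3

theorem Estimates.mono {K L : ℝ} (h : Estimates Φ m D s t₀ T B K) (hKL : K ≤ L) :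
    Estimates Φ m D s t₀ T B L where
  nonneg := h.nonneg.trans hKL
  vel p := (h.vel p).trans hKL
  acc p := (h.acc p).trans hKL
  vel_sub p q hpq := (h.vel_sub p q hpq).trans (by gcongr)
  ω_sub p q hpq := (h.ω_sub p q hpq).trans (by gcongr)
  rot_sub p q hpq := (h.rot_sub p q hpq).trans (by gcongr)
  ω_taylor p q hpq := (h.ω_taylor p q hpq).trans (by gcongr)
  ω_trapezoid p q hpq := (h.ω_trapezoid p q hpq).trans (by gcongr)
  rot_trapezoid p q hpq := (h.rot_trapezoid p q hpq).trans (by gcongr)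

theorem exists_estimates (hm : 0 < m) (hΦ : ContDiffOn ℝ 2 (derivWithin Φ (Ici 0)) (Ici 0))
    (hT : t₀ < T) (hW : ∀ t ∈ Icc t₀ T, (s t).W.PosDef) (hs : IsSmoothSignal 2 s t₀ T) :
    ∃ K, Estimates Φ m D s t₀ T B K := by
  let X := SolutionPoint Φ m D s t₀ T B
  let At : Subalgebra ℝ (X → ℝ) := taylorAlg rel inc
  let Al : Subalgebra ℝ (X → ℝ) := lipAlg rel inc
  have hpos : ∀ p : X, p.data.W.PosDef := fun p => hW _ p.mem_Icc
  have hΩ : ∀ i, (fun p : X => p.data.Ω i) ∈ At := fun i => time_mem_taylorAlg hT (hs.Ω i)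
  have hE : EntriesMem At fun p : X => p.data.E := fun i j => time_mem_taylorAlg hT (hs.E i j)
  have hU : EntriesMem At fun p : X => p.data.U := fun i j => time_mem_taylorAlg hT (hs.U i j)
  have hWm : EntriesMem At fun p : X => p.data.W := fun i j => time_mem_taylorAlg hT (hs.W i j)
  have hRb : EntriesMem (bddAlg X) fun p : X => p.state.rot := fun i j =>
    ⟨1, fun p => (abs_entry_le_norm _ i j).trans (norm_rot p.state).le⟩
  have hωb : ∀ i, (fun p : X => p.state.ω i) ∈ bddAlg X := fun i =>
    ⟨B, fun p => (abs_apply_le_l2 _ i).trans (p.bound _ p.mem)⟩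
  have hdω : ∀ i, IsDeriv (fun x τ => (x τ).ω i)
      (fun p : X => accel Φ m D p.data p.state i) := fun i p =>
    p.sol.hasDerivWithinAt_ω hm p.mem i
  have hdR : ∀ i j, IsDeriv (fun x τ => (x τ).rot i j)
      (fun p : X => (p.state.rot * hat (estVel p.data p.state)) i j) := fun i j p =>
    (p.sol p.τ p.mem).1 i j
  -- The bootstrap starts from bounded states: bounded derivatives make the states Lipschitz, hence
  -- the derivatives Lipschitz, hence the states and finally the derivatives expandable. Each rung
  -- applies `accel_mem` in the next subalgebra.
  have hab : ∀ i, (fun p : X => accel Φ m D p.data p.state i) ∈ bddAlg X :=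
    accel_mem (fun i => (hΩ i).1.1) (fun i j => (hE i j).1.1) (fun i j => (hU i j).1.1)
      (fun i j => (hWm i j).1.1) hRb hωb hpos
      (fun g hg h0 => comp_mem_bddAlg hΦ.continuousOn hg h0)
  have hωl : ∀ i, (fun p : X => p.state.ω i) ∈ Al := fun i => (hdω i).mem_lipAlg (hab i) (hωb i)
  have hvb : ∀ i, (fun p : X => estVel p.data p.state i) ∈ bddAlg X := fun i =>
    sub_mem (hΩ i).1.1 (hωb i)
  have hRl : EntriesMem Al fun p : X => p.state.rot := fun i j =>
    (hdR i j).mem_lipAlg (hRb.mul (entriesMem_hat hvb) i j) (hRb i j)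
  have hvl : ∀ i, (fun p : X => estVel p.data p.state i) ∈ Al := fun i =>
    sub_mem (hΩ i).1 (hωl i)
  have hal : ∀ i, (fun p : X => accel Φ m D p.data p.state i) ∈ Al :=
    accel_mem (fun i => (hΩ i).1) (fun i j => (hE i j).1) (fun i j => (hU i j).1)
      (fun i j => (hWm i j).1) hRl hωl hpos
      (fun g hg h0 => comp_mem_lipAlg (hΦ.of_le (by norm_num)) hg h0)
  have hωt : ∀ i, (fun p : X => p.state.ω i) ∈ At := fun i =>
    (hdω i).mem_taylorAlg (hal i) (hωb i)
  have hRt : EntriesMem At fun p : X => p.state.rot := fun i j =>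
    (hdR i j).mem_taylorAlg (hRl.mul (entriesMem_hat hvl) i j) (hRb i j)
  have hvt : ∀ i, (fun p : X => estVel p.data p.state i) ∈ At := fun i =>
    sub_mem (hΩ i) (hωt i)
  have hat' : ∀ i, (fun p : X => accel Φ m D p.data p.state i) ∈ At :=
    accel_mem hΩ hE hU hWm hRt hωt hpos (fun g hg h0 => comp_mem_taylorAlg hΦ hg h0)
  let S : Set (X × X) := {y | rel y.1 y.2}
  obtain ⟨K₁, h₁, H₁⟩ := exists_l2_le (S := (univ : Set X))
    (v := fun p => estVel p.data p.state) (c := fun _ => 1) (fun _ _ => zero_le_one) (fun i => by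
      obtain ⟨K, hK⟩ := hvb i
      exact ⟨K, fun p _ => by rw [mul_one]; exact hK p⟩)
  obtain ⟨K₀, h₀, H₀⟩ := exists_l2_le (S := (univ : Set X))
    (v := fun p => accel Φ m D p.data p.state) (c := fun _ => 1)
    (fun _ _ => zero_le_one) (fun i => by
      obtain ⟨K, hK⟩ := hab i
      exact ⟨K, fun p _ => by rw [mul_one]; exact hK p⟩)
  obtain ⟨K₂, h₂, H₂⟩ := exists_l2_le (S := S)
    (v := fun y => estVel y.2.data y.2.state - estVel y.1.data y.1.state)
    (c := fun y => |inc y.1 y.2|) (fun _ _ => abs_nonneg _) (fun i => by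
      obtain ⟨-, K, hK⟩ := hvl i
      exact ⟨K, fun y hy => hK _ _ hy⟩)
  obtain ⟨K₃, h₃, H₃⟩ := exists_l2_le (S := S) (v := fun y => y.2.state.ω - y.1.state.ω)
    (c := fun y => |inc y.1 y.2|) (fun _ _ => abs_nonneg _) (fun i => by
      obtain ⟨-, K, hK⟩ := hωl i
      exact ⟨K, fun y hy => hK _ _ hy⟩)
  obtain ⟨K₄, h₄, H₄⟩ := exists_norm_le (S := S) (A := fun y => y.2.state.rot - y.1.state.rot)
    (c := fun y => |inc y.1 y.2|) (fun _ _ => abs_nonneg _) (fun i j => by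
      obtain ⟨-, K, hK⟩ := hRl i j
      exact ⟨K, fun y hy => hK _ _ hy⟩)
  obtain ⟨K₅, h₅, H₅⟩ := exists_l2_le (S := S)
    (v := fun y => y.2.state.ω - y.1.state.ω - inc y.1 y.2 • accel Φ m D y.1.data y.1.state)
    (c := fun y => |inc y.1 y.2| ^ 2) (fun _ _ => by positivity) (fun i => by
      obtain ⟨K, hK⟩ := (hdω i).exists_abs_sub_sub_le (hal i)
      exact ⟨K, fun y hy => by rw [sq_abs]; exact hK _ _ hy⟩)
  obtain ⟨K₆, h₆, H₆⟩ := exists_l2_le (S := S)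
    (v := fun y => y.2.state.ω - y.1.state.ω - (inc y.1 y.2 / 2) •
      (accel Φ m D y.1.data y.1.state + accel Φ m D y.2.data y.2.state))
    (c := fun y => |inc y.1 y.2| ^ 3) (fun _ _ => by positivity) (fun i => by
      obtain ⟨K, hK⟩ := (hdω i).exists_trapezoid_le (hat' i)
      exact ⟨K, fun y hy => hK _ _ hy⟩)
  obtain ⟨K₇, h₇, H₇⟩ := exists_norm_le (S := S)
    (A := fun y => y.2.state.rot - y.1.state.rot - (inc y.1 y.2 / 2) •
      (y.1.state.rot * hat (estVel y.1.data y.1.state) +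
        y.2.state.rot * hat (estVel y.2.data y.2.state)))
    (c := fun y => |inc y.1 y.2| ^ 3) (fun _ _ => by positivity) (fun i j => by
      obtain ⟨K, hK⟩ := (hdR i j).exists_trapezoid_le (hRt.mul (entriesMem_hat hvt) i j)
      exact ⟨K, fun y hy => hK _ _ hy⟩)
  have hle : ∀ {a c K : ℝ}, a ≤ K * c → 0 ≤ c → K ≤ K₀ + K₁ + K₂ + K₃ + K₄ + K₅ + K₆ + K₇ →
      a ≤ (K₀ + K₁ + K₂ + K₃ + K₄ + K₅ + K₆ + K₇) * c := fun h hc hK =>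
    h.trans (mul_le_mul_of_nonneg_right hK hc)
  refine ⟨K₀ + K₁ + K₂ + K₃ + K₄ + K₅ + K₆ + K₇, by positivity, fun p => ?_, fun p => ?_,
    fun p q h => ?_, fun p q h => ?_, fun p q h => ?_, fun p q h => ?_, fun p q h => ?_, fun p q h => ?_⟩
  · have := hle (H₁ p (mem_univ p)) zero_le_one (by linarith)
    rwa [mul_one] at this
  · have := hle (H₀ p (mem_univ p)) zero_le_one (by linarith)
    rwa [mul_one] at this
  · exact hle (H₂ (p, q) h) (abs_nonneg _) (by linarith)
  · exact hle (H₃ (p, q) h) (abs_nonneg _) (by linarith)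
  · exact hle (H₄ (p, q) h) (abs_nonneg _) (by linarith)
  · exact hle (H₅ (p, q) h) (by positivity) (by linarith)
  · exact hle (H₆ (p, q) h) (by positivity) (by linarith)
  · exact hle (H₇ (p, q) h) (by positivity) (by linarith)

end SolutionPoint

end Regularity

/-! ### Consistency: defects of exact solutions. -/

section Consistency

variable {n : ℕ} {Φ : ℝ → ℝ} {m : ℝ} {D : Matrix (Fin 3) (Fin 3) ℝ} {s : ℝ → Measurement n}
  {t₀ T B F K h : ℝ}

theorem l2_mulVec_le_mul {A : Matrix (Fin 3) (Fin 3) ℝ} {v : Fin 3 → ℝ} {c d : ℝ} (hA : ‖A‖ ≤ c)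
    (hv : l2 v ≤ d) : l2 (A *ᵥ v) ≤ c * d :=
  (l2_mulVec_le A v).trans (mul_le_mul hA hv (l2_nonneg v) ((norm_nonneg A).trans hA))

theorem norm_mul_le_mul {A A' : Matrix (Fin 3) (Fin 3) ℝ} {c d : ℝ} (hA : ‖A‖ ≤ c)
    (hA' : ‖A'‖ ≤ d) : ‖A * A'‖ ≤ c * d :=
  (norm_mul_le A A').trans (mul_le_mul hA hA' (norm_nonneg A') ((norm_nonneg A).trans hA))

/-- The residual of the velocity update. -/
noncomputable def residual (Φ : ℝ → ℝ) (m : ℝ) (D : Matrix (Fin 3) (Fin 3) ℝ) (h : ℝ)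
    (a b : Measurement n) (x y : FilterState) : Fin 3 → ℝ :=
  NormedSpace.exp ((h / 2) • hat (estVel b y)) *ᵥ (m • y.ω) -
    ((m • (1 : Matrix (Fin 3) (Fin 3) ℝ) - (h / 2) • D) *ᵥ midVel Φ m D h a x +
      (h / 2) • forcing Φ b y)

namespace SolutionPoint

theorem Estimates.l2_midVel_sub_le (hm : 0 < m) (hD : D.PosDef)
    (hK : Estimates Φ m D s t₀ T B K) (hB : B ≤ K) (hDK : ‖D‖ ≤ K) (hh : 0 ≤ h)
    (p : SolutionPoint Φ m D s t₀ T B) :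
    l2 (midVel Φ m D h p.data p.state - p.state.ω - (h / 2) •
      accel Φ m D p.data p.state) ≤ (K ^ 3 + K ^ 2 / m) * h ^ 2 := by
  have hK0 := hK.nonneg
  set w := midVel Φ m D h p.data p.state
  set c := accel Φ m D p.data p.state with hc
  set A := hat (estVel p.data p.state)
  set ρ := NormedSpace.exp (hat (-(h / 2) • estVel p.data p.state)) - 1 -
    hat (-(h / 2) • estVel p.data p.state)
  have hv : l2 (-(h / 2) • estVel p.data p.state) ≤ h / 2 * K := by
    rw [l2_smul, abs_neg, abs_of_nonneg (by positivity)]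
    exact mul_le_mul_of_nonneg_left (hK.vel p) (by positivity)
  have hρ : ‖ρ‖ ≤ (h / 2 * K) ^ 2 := (norm_exp_hat_sub_one_sub_le _).trans
    (pow_le_pow_left₀ (l2_nonneg _) hv 2)
  have hω : l2 p.state.ω ≤ K := (p.bound _ p.mem).trans hB
  have hw := mulVec_midVel (Φ := Φ) (a := p.data) (x := p.state)
    (isUnit_smul_one_add_smul hm hD hh)
  have hacc := smul_accel (Φ := Φ) (D := D) hm p.data p.state
  have hexp : NormedSpace.exp (-(h / 2) • A) = 1 + -(h / 2) • A + ρ := by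
    simp only [ρ, A, hat_smul]; abel
  -- Eliminating the forcing by means of the differential equation cancels everything of order below
  -- `h²`.
  have e : (m • (1 : Matrix (Fin 3) (Fin 3) ℝ) + (h / 2) • D) *ᵥ
      (w - p.state.ω - (h / 2) • c) = m • (ρ *ᵥ p.state.ω) - (h ^ 2 / 4) • (D *ᵥ c) := by
    have hf : forcing Φ p.data p.state = m • c + m • (A *ᵥ p.state.ω) + D *ᵥ p.state.ω := by
      rw [hc, hacc]; abel
    rw [Matrix.mulVec_sub, Matrix.mulVec_sub, hw, hexp, hf]
    simp only [Matrix.add_mulVec, Matrix.one_mulVec, Matrix.smul_mulVec, Matrix.mulVec_smul]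
    module
  have h1 := mul_l2_le_of_posDef (m := m) hD hh (w - p.state.ω - (h / 2) • c)
  rw [e] at h1
  have h2 := h1.trans (l2_sub_le _ _)
  rw [l2_smul_of_nonneg hm.le, l2_smul_of_nonneg (by positivity)] at h2
  have h3 := mul_le_mul_of_nonneg_left (l2_mulVec_le_mul hρ hω) hm.le
  have h4 := mul_le_mul_of_nonneg_left (l2_mulVec_le_mul hDK (hK.acc p))
    (show 0 ≤ h ^ 2 / 4 by positivity)
  rw [← mul_le_mul_iff_right₀ hm]
  have e2 : m * ((K ^ 3 + K ^ 2 / m) * h ^ 2) = m * K ^ 3 * h ^ 2 + K ^ 2 * h ^ 2 := by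
    field_simp
  have h5 : 0 ≤ m * K ^ 3 * h ^ 2 := by positivity
  have h6 : 0 ≤ K ^ 2 * h ^ 2 := by positivity
  rw [e2]
  refine (h2.trans (add_le_add h3 h4)).trans ?_
  nlinarith

theorem Estimates.l2_midVel_sub_average_le (hm : 0 < m) (hD : D.PosDef)
    (hK : Estimates Φ m D s t₀ T B K) (hB : B ≤ K) (hDK : ‖D‖ ≤ K) (hh : 0 ≤ h)
    {p q : SolutionPoint Φ m D s t₀ T B} (hpq : rel p q) (hinc : inc p q = h) :
    l2 (midVel Φ m D h p.data p.state - (1 / 2 : ℝ) • (p.state.ω + q.state.ω)) ≤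
      (K ^ 3 + K ^ 2 / m + K) * h ^ 2 := by
  have h1 := hK.l2_midVel_sub_le hm hD hB hDK hh p
  have h2 := hK.ω_taylor p q hpq
  rw [hinc, abs_of_nonneg hh] at h2
  set c := accel Φ m D p.data p.state
  have e : midVel Φ m D h p.data p.state - (1 / 2 : ℝ) • (p.state.ω + q.state.ω) =
      (midVel Φ m D h p.data p.state - p.state.ω - (h / 2) • c) -
        (1 / 2 : ℝ) • (q.state.ω - p.state.ω - h • c) := by module
  rw [e]
  refine (l2_sub_le _ _).trans ?_
  rw [l2_smul_of_nonneg (by norm_num)]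
  have : 0 ≤ K * h ^ 2 := mul_nonneg hK.nonneg (by positivity)
  nlinarith

theorem Estimates.l2_residual_le (hm : 0 < m) (hD : D.PosDef)
    (hK : Estimates Φ m D s t₀ T B K) (hB : B ≤ K) (hDK : ‖D‖ ≤ K) (hh : 0 ≤ h)
    {p q : SolutionPoint Φ m D s t₀ T B} (hpq : rel p q) (hinc : inc p q = h) :
    l2 (residual Φ m D h p.data q.data p.state q.state) ≤
      (m * K + K * (K ^ 3 + K ^ 2 / m + K) + m * K ^ 3 + m * K ^ 4) * h ^ 3 := by
  have hK0 := hK.nonneg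
  have hw := mulVec_midVel (Φ := Φ) (a := p.data) (x := p.state)
    (isUnit_smul_one_add_smul hm hD hh)
  have hwa := hK.l2_midVel_sub_average_le hm hD hB hDK hh hpq hinc
  have ht := hK.ω_trapezoid p q hpq
  have hωs := hK.ω_sub p q hpq
  have hvs := hK.vel_sub p q hpq
  rw [hinc, abs_of_nonneg hh] at ht hωs hvs
  set w := midVel Φ m D h p.data p.state
  set c := accel Φ m D p.data p.state with hc
  set c' := accel Φ m D q.data q.state with hc'
  set A := hat (estVel p.data p.state)
  set A' := hat (estVel q.data q.state)
  set ρ := NormedSpace.exp (hat (-(h / 2) • estVel p.data p.state)) - 1 -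
    hat (-(h / 2) • estVel p.data p.state) - (1 / 2 : ℝ) •
      (hat (-(h / 2) • estVel p.data p.state) * hat (-(h / 2) • estVel p.data p.state))
  set ρ' := NormedSpace.exp (hat ((h / 2) • estVel q.data q.state)) - 1 -
    hat ((h / 2) • estVel q.data q.state) - (1 / 2 : ℝ) •
      (hat ((h / 2) • estVel q.data q.state) * hat ((h / 2) • estVel q.data q.state))
  have hρ : ‖ρ‖ ≤ (h / 2 * K) ^ 3 := by
    refine (norm_exp_hat_sub_one_sub_sub_le _).trans (pow_le_pow_left₀ (l2_nonneg _) ?_ 3)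
    rw [l2_smul, abs_neg, abs_of_nonneg (by positivity)]
    exact mul_le_mul_of_nonneg_left (hK.vel p) (by positivity)
  have hρ' : ‖ρ'‖ ≤ (h / 2 * K) ^ 3 := by
    refine (norm_exp_hat_sub_one_sub_sub_le _).trans (pow_le_pow_left₀ (l2_nonneg _) ?_ 3)
    rw [l2_smul_of_nonneg (by positivity)]
    exact mul_le_mul_of_nonneg_left (hK.vel q) (by positivity)
  have hω : l2 p.state.ω ≤ K := (p.bound _ p.mem).trans hB
  have hω' : l2 q.state.ω ≤ K := (q.bound _ q.mem).trans hB
  have hA : ‖A‖ ≤ K := (norm_hat_le _).trans (hK.vel p)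
  have hA' : ‖A'‖ ≤ K := (norm_hat_le _).trans (hK.vel q)
  have hAA : ‖A' - A‖ ≤ K * h := by
    rw [← hat_sub]; exact (norm_hat_le _).trans hvs
  have hexp : NormedSpace.exp (-(h / 2) • A) =
      1 + -(h / 2) • A + (h ^ 2 / 8) • (A * A) + ρ := by
    simp only [ρ, A, hat_smul, smul_mul_smul_comm]; module
  have hexp' : NormedSpace.exp ((h / 2) • A') =
      1 + (h / 2) • A' + (h ^ 2 / 8) • (A' * A') + ρ' := by
    simp only [ρ', A', hat_smul, smul_mul_smul_comm]; module
  have hf : forcing Φ p.data p.state = m • c + m • (A *ᵥ p.state.ω) + D *ᵥ p.state.ω := by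
    rw [hc, smul_accel hm]; abel
  have hf' : forcing Φ q.data q.state = m • c' + m • (A' *ᵥ q.state.ω) + D *ᵥ q.state.ω := by
    rw [hc', smul_accel hm]; abel
  -- The defect splits into the trapezoidal error, the damping acting on the midpoint error, the
  -- difference of the quadratic exponential terms at the two ends, and cubic remainders. The third
  -- group is telescoped into factors of size `O(h)`, which with its prefactor `h²` gives order
  -- three.
  have e : residual Φ m D h p.data q.data p.state q.state =
      m • (q.state.ω - p.state.ω - (h / 2) • (c + c')) +
      h • (D *ᵥ (w - (1 / 2 : ℝ) • (p.state.ω + q.state.ω))) +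
      (m * (h ^ 2 / 8)) • ((A' *ᵥ (A' *ᵥ (q.state.ω - p.state.ω)) +
        A' *ᵥ ((A' - A) *ᵥ p.state.ω)) + (A' - A) *ᵥ (A *ᵥ p.state.ω)) +
      m • (ρ' *ᵥ q.state.ω - ρ *ᵥ p.state.ω) := by
    have e1 : (m • (1 : Matrix (Fin 3) (Fin 3) ℝ) - (h / 2) • D) *ᵥ w =
        (m • (1 : Matrix (Fin 3) (Fin 3) ℝ) + (h / 2) • D) *ᵥ w - h • (D *ᵥ w) := by
      rw [smul_one_sub_smul_mulVec, smul_one_add_smul_mulVec]; module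
    rw [residual, e1, hw, hexp, hexp', hf, hf']
    simp only [Matrix.add_mulVec, Matrix.sub_mulVec, Matrix.one_mulVec, Matrix.smul_mulVec,
      Matrix.mulVec_smul, Matrix.mulVec_sub, Matrix.mulVec_add, ← Matrix.mulVec_mulVec]
    module
  have b1 := mul_le_mul_of_nonneg_left ht hm.le
  have b2 := mul_le_mul_of_nonneg_left (l2_mulVec_le_mul hDK hwa) hh
  have b3 := (l2_add_le (A' *ᵥ (A' *ᵥ (q.state.ω - p.state.ω)) + A' *ᵥ ((A' - A) *ᵥ p.state.ω))
    ((A' - A) *ᵥ (A *ᵥ p.state.ω))).trans (add_le_add ((l2_add_le _ _).trans (add_le_add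
      (l2_mulVec_le_mul hA' (l2_mulVec_le_mul hA' hωs))
      (l2_mulVec_le_mul hA' (l2_mulVec_le_mul hAA hω))))
      (l2_mulVec_le_mul hAA (l2_mulVec_le_mul hA hω)))
  have b4 := (l2_sub_le (ρ' *ᵥ q.state.ω) (ρ *ᵥ p.state.ω)).trans
    (add_le_add (l2_mulVec_le_mul hρ' hω') (l2_mulVec_le_mul hρ hω))
  have b3' := mul_le_mul_of_nonneg_left b3 (show 0 ≤ m * (h ^ 2 / 8) by positivity)
  have b4' := mul_le_mul_of_nonneg_left b4 hm.le
  rw [e]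
  refine (l2_add_le _ _).trans ((add_le_add ((l2_add_le _ _).trans (add_le_add
    ((l2_add_le _ _).trans (add_le_add
      ((l2_smul_of_nonneg hm.le _).trans_le b1) ((l2_smul_of_nonneg hh _).trans_le b2)))
      ((l2_smul_of_nonneg (by positivity) _).trans_le b3')))
      ((l2_smul_of_nonneg hm.le _).trans_le b4')).trans ?_)
  have p1 : 0 ≤ m * K ^ 3 * h ^ 3 := by positivity
  have p2 : 0 ≤ m * K ^ 4 * h ^ 3 := by positivity
  nlinarith

theorem Estimates.norm_rot_sub_le (hm : 0 < m) (hD : D.PosDef)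
    (hK : Estimates Φ m D s t₀ T B K) (hB : B ≤ K) (hDK : ‖D‖ ≤ K) (hh : 0 ≤ h)
    {p q : SolutionPoint Φ m D s t₀ T B} (hpq : rel p q) (hinc : inc p q = h) :
    ‖q.state.rot - p.state.rot * NormedSpace.exp (h • hat (midΩ p.data q.data -
      midVel Φ m D h p.data p.state))‖ ≤
      (K ^ 3 + K ^ 2 / m + 2 * K + K ^ 2 + K ^ 3) * h ^ 3 := by
  have hK0 := hK.nonneg
  have hwa := hK.l2_midVel_sub_average_le hm hD hB hDK hh hpq hinc
  have ht := hK.rot_trapezoid p q hpq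
  have hRs := hK.rot_sub p q hpq
  have hvs := hK.vel_sub p q hpq
  rw [hinc, abs_of_nonneg hh] at ht hRs hvs
  set w := midVel Φ m D h p.data p.state
  set A := hat (estVel p.data p.state)
  set A' := hat (estVel q.data q.state)
  set R := p.state.rot
  set R' := q.state.rot
  have hR : ‖R‖ = 1 := norm_rot _
  have hR' : ‖R'‖ = 1 := norm_rot _
  -- The average of the end velocities. Half of its rotation is moved to the other side, so that the
  -- expansion is symmetric in the two ends and its quadratic terms leave only `(R' - R) * hat β ^
  -- 2`.
  set β : Fin 3 → ℝ := (1 / 2 : ℝ) • (estVel p.data p.state + estVel q.data q.state) with hβdef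
  have hβ : l2 β ≤ K := by
    rw [hβdef, l2_smul_of_nonneg (by norm_num)]
    linarith [l2_add_le (estVel p.data p.state) (estVel q.data q.state), hK.vel p, hK.vel q]
  have hBA : hat β = (1 / 2 : ℝ) • (A + A') := by rw [hβdef, hat_smul, hat_add]
  have hAA : ‖A' - A‖ ≤ K * h := by
    rw [← hat_sub]; exact (norm_hat_le _).trans hvs
  set ρ := NormedSpace.exp (hat ((h / 2) • β)) - 1 - hat ((h / 2) • β) -
    (1 / 2 : ℝ) • (hat ((h / 2) • β) * hat ((h / 2) • β))
  set ρ' := NormedSpace.exp (hat (-(h / 2) • β)) - 1 - hat (-(h / 2) • β) -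
    (1 / 2 : ℝ) • (hat (-(h / 2) • β) * hat (-(h / 2) • β))
  have hρ : ‖ρ‖ ≤ (h / 2 * K) ^ 3 := by
    refine (norm_exp_hat_sub_one_sub_sub_le _).trans (pow_le_pow_left₀ (l2_nonneg _) ?_ 3)
    rw [l2_smul_of_nonneg (by positivity)]
    exact mul_le_mul_of_nonneg_left hβ (by positivity)
  have hρ' : ‖ρ'‖ ≤ (h / 2 * K) ^ 3 := by
    refine (norm_exp_hat_sub_one_sub_sub_le _).trans (pow_le_pow_left₀ (l2_nonneg _) ?_ 3)
    rw [l2_smul, abs_neg, abs_of_nonneg (by positivity)]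
    exact mul_le_mul_of_nonneg_left hβ (by positivity)
  have hexp : NormedSpace.exp ((h / 2) • hat β) =
      1 + (h / 2) • hat β + (h ^ 2 / 8) • (hat β * hat β) + ρ := by
    simp only [ρ, hat_smul, smul_mul_smul_comm]; module
  have hexp' : NormedSpace.exp (-(h / 2) • hat β) =
      1 + -(h / 2) • hat β + (h ^ 2 / 8) • (hat β * hat β) + ρ' := by
    simp only [ρ', hat_smul, smul_mul_smul_comm]; module
  have e : R' * NormedSpace.exp (-(h / 2) • hat β) - R * NormedSpace.exp ((h / 2) • hat β) =
      (R' - R - (h / 2) • (R * A + R' * A')) + (h / 4) • ((R' - R) * (A' - A)) +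
      (h ^ 2 / 8) • ((R' - R) * (hat β * hat β)) + (R' * ρ' - R * ρ) := by
    rw [hexp, hexp']
    generalize hat β * hat β = Q
    rw [hBA]
    simp only [mul_add, sub_mul, mul_sub, mul_one, mul_smul_comm]
    module
  have hβ' : ‖hat β‖ ≤ K := (norm_hat_le β).trans hβ
  have b2 := mul_le_mul_of_nonneg_left (norm_mul_le_mul hRs hAA) (show 0 ≤ h / 4 by positivity)
  have b3 := mul_le_mul_of_nonneg_left (norm_mul_le_mul hRs (norm_mul_le_mul hβ' hβ'))
    (show 0 ≤ h ^ 2 / 8 by positivity)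
  have b4 := (norm_sub_le (R' * ρ') (R * ρ)).trans
    (add_le_add (norm_mul_le_mul hR'.le hρ') (norm_mul_le_mul hR.le hρ))
  have hns : ∀ {c : ℝ} (M : Matrix (Fin 3) (Fin 3) ℝ), 0 ≤ c → ‖c • M‖ = c * ‖M‖ := fun M hc => by
    rw [norm_smul, Real.norm_of_nonneg hc]
  have key : ‖R' * NormedSpace.exp (-(h / 2) • hat β) - R * NormedSpace.exp ((h / 2) • hat β)‖ ≤
      (K + K ^ 2 + K ^ 3) * h ^ 3 := by
    rw [e]
    refine (norm_add_le _ _).trans ((add_le_add ((norm_add_le _ _).trans (add_le_add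
      ((norm_add_le _ _).trans (add_le_add ht ((hns _ (by positivity)).trans_le b2)))
      ((hns _ (by positivity)).trans_le b3))) b4).trans ?_)
    have p1 : 0 ≤ K ^ 2 * h ^ 3 := by positivity
    have p2 : 0 ≤ K ^ 3 * h ^ 3 := by positivity
    nlinarith
  have key2 : ‖R' - R * NormedSpace.exp (h • hat β)‖ ≤ (K + K ^ 2 + K ^ 3) * h ^ 3 := by
    have e1 : R' - R * NormedSpace.exp (h • hat β) =
        (R' * NormedSpace.exp (-(h / 2) • hat β) - R * NormedSpace.exp ((h / 2) • hat β)) *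
          NormedSpace.exp ((h / 2) • hat β) := by
      rw [sub_mul, Matrix.mul_assoc, exp_neg_smul_mul_exp_smul, Matrix.mul_one, Matrix.mul_assoc,
        ← Matrix.exp_add_of_commute _ _ (Commute.refl _), ← add_smul, add_halves]
    rw [e1]
    refine (norm_mul_le_mul key ?_).trans_eq (mul_one _)
    rw [← hat_smul]
    exact (norm_exp_hat _).le
  -- The scheme uses `midΩ - midVel` in place of `β`; their difference is the midpoint error
  -- `O(h²)`, and the factor `h` makes it `O(h³)`.
  have key3 : ‖R * NormedSpace.exp (h • hat β) -
      R * NormedSpace.exp (h • hat (midΩ p.data q.data - w))‖ ≤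
      (K ^ 3 + K ^ 2 / m + K) * h ^ 3 := by
    rw [← mul_sub, ← hat_smul, ← hat_smul]
    refine (norm_mul_le_mul hR.le (norm_exp_hat_sub_exp_hat_le _ _)).trans ?_
    have e2 : h • β - h • (midΩ p.data q.data - w) =
        h • (w - (1 / 2 : ℝ) • (p.state.ω + q.state.ω)) := by
      rw [hβdef, midΩ, estVel, estVel]; module
    rw [e2, l2_smul_of_nonneg hh, one_mul]
    exact (mul_le_mul_of_nonneg_left hwa hh).trans (le_of_eq (by ring))
  refine (norm_sub_le_norm_sub_add_norm_sub _ (R * NormedSpace.exp (h • hat β)) _).trans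
    ((add_le_add key2 key3).trans (le_of_eq (by ring)))

end SolutionPoint

end Consistency

/-! ### Stability: propagation of errors over one step. -/

section Stability

variable {n : ℕ} {Φ : ℝ → ℝ} {m : ℝ} {D : Matrix (Fin 3) (Fin 3) ℝ}
  {h κ ε B L : ℝ} {a b : Measurement n} {x y x' y' : FilterState}

/-- The distance of two states. -/
noncomputable def stateDist (x y : FilterState) : ℝ := l2 (x.ω - y.ω) + ‖x.rot - y.rot‖

theorem stateDist_nonneg (x y : FilterState) : 0 ≤ stateDist x y :=
  add_nonneg (l2_nonneg _) (norm_nonneg _)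

theorem stateDist_self (x : FilterState) : stateDist x x = 0 := by
  simp [stateDist, l2_zero]

theorem errorLE_of_stateDist_le (hxy : stateDist x y ≤ ε) : ErrorLE x y ε :=
  ⟨fun i j => (abs_entry_le_norm (x.rot - y.rot) i j).trans
    ((le_add_of_nonneg_left (l2_nonneg _)).trans hxy),
  fun i => (abs_apply_le_l2 (x.ω - y.ω) i).trans
    ((le_add_of_nonneg_right (norm_nonneg _)).trans hxy)⟩

theorem exists_forcing_lipschitz (hΦ : ContDiffOn ℝ 1 (derivWithin Φ (Ici 0)) (Ici 0))
    {s : ℝ → Measurement n} {t₀ T : ℝ}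
    (hW : ∀ t ∈ Icc t₀ T, (s t).W.PosDef) (hs : IsSmoothSignal 0 s t₀ T) :
    ∃ L, ∀ t ∈ Icc t₀ T, ∀ x y,
      l2 (forcing Φ (s t) x - forcing Φ (s t) y) ≤ L * ‖x.rot - y.rot‖ := by
  let X := Icc t₀ T × FilterState
  -- Pairs are compared at equal times only, with the rotation distance as increment; the data are
  -- then constant along the relation.
  let r : X → X → Prop := fun p q => p.1 = q.1
  let d : X → X → ℝ := fun p q => ‖q.2.rot - p.2.rot‖
  have hc : ∀ f : ℝ → ℝ, ContDiffOn ℝ (0 : ℕ) f (Icc t₀ T) →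
      (fun p : X => f p.1) ∈ lipAlg r d := by
    intro f hf
    obtain ⟨C, -, hC⟩ := exists_abs_le_of_continuousOn hf.continuousOn
    refine ⟨⟨C, fun p => hC _ p.1.2⟩, 0, fun p q hpq => ?_⟩
    have : p.1 = q.1 := hpq
    simp [this]
  have h := fun i => forcing_mem (A := lipAlg r d) (Φ := Φ)
    (a := fun p => s p.1) (x := fun p => p.2)
    (fun i j => hc _ (hs.E i j)) (fun i j => hc _ (hs.U i j)) (fun i j => hc _ (hs.W i j))
    (fun i j => ⟨⟨1, fun p => (abs_entry_le_norm _ i j).trans (norm_rot p.2).le⟩, 1,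
      fun p q _ => by
        rw [one_mul, abs_of_nonneg (norm_nonneg _)]
        exact abs_entry_le_norm (q.2.rot - p.2.rot) i j⟩)
    (fun p => hW _ p.1.2) (fun g hg h0 => comp_mem_lipAlg hΦ hg h0) i
  obtain ⟨L, -, hL⟩ := exists_l2_le (S := {z : X × X | r z.1 z.2})
    (v := fun z => forcing Φ (s z.2.1) z.2.2 - forcing Φ (s z.1.1) z.1.2)
    (c := fun z => |d z.1 z.2|) (fun _ _ => abs_nonneg _) (fun i => by
      obtain ⟨-, K, hK⟩ := h i
      exact ⟨K, fun z hz => hK _ _ hz⟩)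
  refine ⟨L, fun t ht x y => ?_⟩
  have := hL ((⟨t, ht⟩, y), (⟨t, ht⟩, x)) rfl
  rwa [abs_of_nonneg (norm_nonneg _)] at this

/-- After the isometric part `exp (c • hat (estVel a x)) *ᵥ (x.ω - x'.ω)` is removed, what remains
is the difference of the exponentials acting on `x'.ω`. Thus only the reference velocity needs a
bound, never the discrete one. -/
theorem l2_exp_mulVec_sub_sub_le (c : ℝ) (hB : l2 x'.ω ≤ B) :
    l2 (NormedSpace.exp (c • hat (estVel a x)) *ᵥ x.ω -
      NormedSpace.exp (c • hat (estVel a x')) *ᵥ x'.ω -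
      NormedSpace.exp (c • hat (estVel a x)) *ᵥ (x.ω - x'.ω)) ≤ |c| * B * l2 (x.ω - x'.ω) := by
  have e : NormedSpace.exp (c • hat (estVel a x)) *ᵥ x.ω -
      NormedSpace.exp (c • hat (estVel a x')) *ᵥ x'.ω -
      NormedSpace.exp (c • hat (estVel a x)) *ᵥ (x.ω - x'.ω) =
      (NormedSpace.exp (hat (c • estVel a x)) - NormedSpace.exp (hat (c • estVel a x'))) *ᵥ
        x'.ω := by
    rw [Matrix.mulVec_sub, Matrix.sub_mulVec, hat_smul, hat_smul]; abel
  rw [e]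
  have h1 := norm_exp_hat_sub_exp_hat_le (c • estVel a x) (c • estVel a x')
  rw [← smul_sub, l2_smul, estVel, estVel, sub_sub_sub_cancel_left, l2_sub_comm] at h1
  exact (l2_mulVec_le_mul h1 hB).trans (le_of_eq (by ring))

theorem mul_l2_midVel_sub_midVel_le (hm : 0 < m) (hD : D.PosDef) (hh : 0 ≤ h)
    (hB : l2 x'.ω ≤ B)
    (hL : l2 (forcing Φ a x - forcing Φ a x') ≤ L * ‖x.rot - x'.rot‖) :
    m * l2 (midVel Φ m D h a x - midVel Φ m D h a x') ≤
      m * ((1 + h / 2 * B) * l2 (x.ω - x'.ω)) + h / 2 * (L * ‖x.rot - x'.rot‖) := by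
  have hu := isUnit_smul_one_add_smul hm hD hh
  have h1 := mul_l2_le_of_posDef (m := m) hD hh (midVel Φ m D h a x - midVel Φ m D h a x')
  have h2 := l2_exp_mulVec_sub_sub_le (x := x) (a := a) (-(h / 2)) hB
  rw [abs_neg, abs_of_nonneg (by positivity)] at h2
  set E := NormedSpace.exp (-(h / 2) • hat (estVel a x)) with hE
  set E' := NormedSpace.exp (-(h / 2) • hat (estVel a x'))
  have e : (m • (1 : Matrix (Fin 3) (Fin 3) ℝ) + (h / 2) • D) *ᵥ
      (midVel Φ m D h a x - midVel Φ m D h a x') =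
      m • ((E *ᵥ x.ω - E' *ᵥ x'.ω - E *ᵥ (x.ω - x'.ω)) + E *ᵥ (x.ω - x'.ω)) +
        (h / 2) • (forcing Φ a x - forcing Φ a x') := by
    rw [Matrix.mulVec_sub, mulVec_midVel hu, mulVec_midVel hu, Matrix.mulVec_smul,
      Matrix.mulVec_smul]
    module
  rw [e] at h1
  refine h1.trans ((l2_add_le _ _).trans (add_le_add ?_ ?_))
  · rw [l2_smul_of_nonneg hm.le]
    refine mul_le_mul_of_nonneg_left ((l2_add_le _ _).trans ?_) hm.le
    rw [hE, l2_exp_smul_hat_mulVec, add_mul, one_mul, add_comm]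
    exact add_le_add_right h2 _
  · rw [l2_smul_of_nonneg (by positivity)]
    exact mul_le_mul_of_nonneg_left hL (by positivity)

/-- Here `x, y` is a genuine step, while `x', y'` satisfies the rotation update only up to the
defect `ε`. -/
theorem norm_rot_sub_rot_le (hh : 0 ≤ h) (hxy : filter2 Φ m D h a b x y)
    (hR : ‖y'.rot - x'.rot * NormedSpace.exp (h • hat (midΩ a b - midVel Φ m D h a x'))‖ ≤ ε) :
    ‖y.rot - y'.rot‖ ≤
      ‖x.rot - x'.rot‖ + h * l2 (midVel Φ m D h a x - midVel Φ m D h a x') + ε := by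
  set E := NormedSpace.exp (hat (h • (midΩ a b - midVel Φ m D h a x))) with hE
  set E' := NormedSpace.exp (hat (h • (midΩ a b - midVel Φ m D h a x'))) with hE'
  rw [← hat_smul, ← hE'] at hR
  have hy := hxy.1
  rw [← hat_smul, ← hE] at hy
  have e : y.rot - y'.rot = (x.rot - x'.rot) * E + x'.rot * (E - E') - (y'.rot - x'.rot * E') := by
    rw [hy, sub_mul, mul_sub]; abel
  rw [e]
  refine (norm_sub_le _ _).trans (add_le_add ((norm_add_le _ _).trans (add_le_add ?_ ?_)) hR)
  · exact (norm_mul_le_mul le_rfl (norm_exp_hat _).le).trans_eq (mul_one _)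
  · have h1 := norm_exp_hat_sub_exp_hat_le (h • (midΩ a b - midVel Φ m D h a x))
      (h • (midΩ a b - midVel Φ m D h a x'))
    rw [← smul_sub, sub_sub_sub_cancel_left, l2_smul_of_nonneg hh, l2_sub_comm] at h1
    exact (norm_mul_le_mul (norm_rot x').le h1).trans_eq (one_mul _)

theorem mul_l2_ω_sub_ω_le (hm : 0 < m) (hh : 0 ≤ h) (hxy : filter2 Φ m D h a b x y)
    (hB : l2 y'.ω ≤ B)
    (hL : l2 (forcing Φ b y - forcing Φ b y') ≤ L * ‖y.rot - y'.rot‖)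
    (hω : l2 (residual Φ m D h a b x' y') ≤ ε) :
    m * l2 (y.ω - y'.ω) ≤ m * (h / 2 * B * l2 (y.ω - y'.ω)) +
      (m + h / 2 * ‖D‖) * l2 (midVel Φ m D h a x - midVel Φ m D h a x') +
      h / 2 * (L * ‖y.rot - y'.rot‖) + ε := by
  have h2 := l2_exp_mulVec_sub_sub_le (x := y) (a := b) (h / 2) hB
  rw [abs_of_nonneg (by positivity)] at h2
  have hy := (eq_exp_mulVec_iff _ _ _ _).1 hxy.2
  set E := NormedSpace.exp ((h / 2) • hat (estVel b y)) with hE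
  set E' := NormedSpace.exp ((h / 2) • hat (estVel b y')) with hE'
  have e : m • (E *ᵥ (y.ω - y'.ω)) =
      ((m • (1 : Matrix (Fin 3) (Fin 3) ℝ) - (h / 2) • D) *ᵥ
        (midVel Φ m D h a x - midVel Φ m D h a x') +
      (h / 2) • (forcing Φ b y - forcing Φ b y')) - residual Φ m D h a b x' y' -
      m • (E *ᵥ y.ω - E' *ᵥ y'.ω - E *ᵥ (y.ω - y'.ω)) := by
    have e1 : m • (E *ᵥ y.ω) = (m • (1 : Matrix (Fin 3) (Fin 3) ℝ) - (h / 2) • D) *ᵥ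
        midVel Φ m D h a x + (h / 2) • forcing Φ b y := by rw [← hy, Matrix.mulVec_smul]
    rw [residual, ← hE', Matrix.mulVec_smul, smul_sub m (_ - _), smul_sub m (E *ᵥ y.ω), e1,
      Matrix.mulVec_sub (m • (1 : Matrix (Fin 3) (Fin 3) ℝ) - (h / 2) • D)]
    module
  have h3 := congrArg l2 e
  rw [l2_smul_of_nonneg hm.le, hE, l2_exp_smul_hat_mulVec, ← hE] at h3
  have h4 := l2_impulse_le (D := D) (h := h) (w := midVel Φ m D h a x - midVel Φ m D h a x')
    hm hL
  rw [abs_of_nonneg hh] at h4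
  have h5 := mul_le_mul_of_nonneg_left h2 hm.le
  rw [h3]
  refine (l2_sub_le _ _).trans ((add_le_add ((l2_sub_le _ _).trans (add_le_add h4 hω))
    ((l2_smul_of_nonneg hm.le _).trans_le h5)).trans (le_of_eq (by ring)))

/-- The scalar core of stability: `e`, `r` and `d` are the velocity, rotation and midpoint velocity
errors. The implicit term `h * κ * e₁` is absorbed on the left because `h * κ ≤ 1 / 4`. -/
theorem error_recursion {e₀ r₀ d e₁ r₁ : ℝ} (he₀ : 0 ≤ e₀) (hr₀ : 0 ≤ r₀)
    (hκ : 1 ≤ κ) (hh : 0 ≤ h) (hhκ : h * κ ≤ 1 / 4) (hε : 0 ≤ ε)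
    (hd : d ≤ (1 + h * κ) * e₀ + h * κ * r₀) (hr : r₁ ≤ r₀ + h * d + ε)
    (he : e₁ ≤ h * κ * e₁ + (1 + h * κ) * d + h * κ * r₁ + κ * ε) :
    e₁ + r₁ ≤ (1 + 16 * κ * h) * (e₀ + r₀) + 5 * κ * ε := by
  set q := h * κ
  have hq : 0 ≤ q := by positivity
  have hhq : h ≤ q := le_mul_of_one_le_right hh hκ
  have hu : 0 ≤ e₀ + r₀ := by positivity
  have hd1 : d ≤ e₀ + q * (e₀ + r₀) := by linarith
  have hd2 : d ≤ 2 * (e₀ + r₀) := by nlinarith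
  have hr1 : r₁ ≤ r₀ + 2 * (q * (e₀ + r₀)) + ε := by nlinarith
  have hqu : 0 ≤ q * (e₀ + r₀) := by positivity
  have hqq : q * (q * (e₀ + r₀)) ≤ 1 / 4 * (q * (e₀ + r₀)) :=
    mul_le_mul_of_nonneg_right hhκ hqu
  have hqε : q * ε ≤ 1 / 4 * ε := mul_le_mul_of_nonneg_right hhκ hε
  have hκε : ε ≤ κ * ε := le_mul_of_one_le_left hε hκ
  have a1 : (1 + q) * d ≤ e₀ + q * (e₀ + r₀) + q * (2 * (e₀ + r₀)) := by
    have := mul_le_mul_of_nonneg_left hd2 hq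
    linarith
  have a2 : q * r₁ ≤ q * (e₀ + r₀) + 1 / 2 * (q * (e₀ + r₀)) + 1 / 4 * ε := by
    have := mul_le_mul_of_nonneg_left hr1 hq
    have : 0 ≤ q * e₀ := by positivity
    linarith
  have a3 : (1 - q) * e₁ ≤ e₀ + 5 * (q * (e₀ + r₀)) + 5 / 4 * (κ * ε) := by linarith
  have a4 : e₁ ≤ e₀ + 14 * (q * (e₀ + r₀)) + 5 / 2 * (κ * ε) := by
    have hκε0 : 0 ≤ κ * ε := hε.trans hκε
    have p1 : q * (κ * ε) ≤ 1 / 4 * (κ * ε) := mul_le_mul_of_nonneg_right hhκ hκε0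
    have p2 : q * e₀ ≤ q * (e₀ + r₀) := mul_le_mul_of_nonneg_left (by linarith) hq
    have p3 : (1 - q) * e₁ ≤ (1 - q) * (e₀ + 14 * (q * (e₀ + r₀)) + 5 / 2 * (κ * ε)) := by
      linarith
    exact le_of_mul_le_mul_left p3 (by linarith)
  have : (1 + 16 * κ * h) * (e₀ + r₀) = e₀ + r₀ + 16 * (q * (e₀ + r₀)) := by ring
  rw [this]
  linarith

/-- Constants large enough for the stability estimate. -/
structure StepConstants (Φ : ℝ → ℝ) (m : ℝ) (D : Matrix (Fin 3) (Fin 3) ℝ) (a b : Measurement n)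
    (B κ : ℝ) : Prop where
  one_le : 1 ≤ κ
  one_le_mul : 1 ≤ κ * m
  norm_le : ‖D‖ ≤ κ * m
  bound_le : B ≤ κ
  lipschitz_left : ∀ x y,
    l2 (forcing Φ a x - forcing Φ a y) ≤ κ * m * ‖x.rot - y.rot‖
  lipschitz_right : ∀ x y,
    l2 (forcing Φ b x - forcing Φ b y) ≤ κ * m * ‖x.rot - y.rot‖

theorem StepConstants.l2_midVel_sub_midVel_le (hc : StepConstants Φ m D a b B κ) (hm : 0 < m)
    (hD : D.PosDef) (hh : 0 ≤ h) (hx' : l2 x'.ω ≤ B) :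
    l2 (midVel Φ m D h a x - midVel Φ m D h a x') ≤
      (1 + h * κ) * l2 (x.ω - x'.ω) + h * κ * ‖x.rot - x'.rot‖ := by
  have h1 := mul_l2_midVel_sub_midVel_le hm hD hh (hx'.trans hc.bound_le)
    (hc.lipschitz_left x x')
  rw [← mul_le_mul_iff_right₀ hm]
  have hκ : 0 ≤ κ := zero_le_one.trans hc.one_le
  have p1 : 0 ≤ m * (h * κ * l2 (x.ω - x'.ω)) := by
    have := l2_nonneg (x.ω - x'.ω); positivity
  have p2 : 0 ≤ m * (h * κ * ‖x.rot - x'.rot‖) := by positivity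
  refine h1.trans ?_
  nlinarith

theorem StepConstants.stateDist_le (hc : StepConstants Φ m D a b B κ) (hm : 0 < m)
    (hD : D.PosDef) (hh : 0 ≤ h) (hhκ : h * κ ≤ 1 / 4) (hxy : filter2 Φ m D h a b x y)
    (hx' : l2 x'.ω ≤ B) (hy' : l2 y'.ω ≤ B)
    (hR : ‖y'.rot - x'.rot * NormedSpace.exp (h • hat (midΩ a b - midVel Φ m D h a x'))‖ ≤ ε)
    (hω : l2 (residual Φ m D h a b x' y') ≤ ε) :
    stateDist y y' ≤ (1 + 16 * κ * h) * stateDist x x' + 5 * κ * ε := by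
  have hκ : 0 ≤ κ := zero_le_one.trans hc.one_le
  have hε : 0 ≤ ε := (l2_nonneg _).trans hω
  have h3 := mul_l2_ω_sub_ω_le hm hh hxy (hy'.trans hc.bound_le) (hc.lipschitz_right y y') hω
  refine error_recursion (l2_nonneg _) (norm_nonneg _) hc.one_le hh hhκ hε
    (hc.l2_midVel_sub_midVel_le hm hD hh hx') (norm_rot_sub_rot_le hh hxy hR) ?_
  rw [← mul_le_mul_iff_right₀ hm]
  refine h3.trans ?_
  have hd := l2_nonneg (midVel Φ m D h a x - midVel Φ m D h a x')
  have he := l2_nonneg (y.ω - y'.ω)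
  have p1 : 0 ≤ m * (h * κ * l2 (y.ω - y'.ω)) := by positivity
  have p2 : 0 ≤ m * (h * κ * ‖y.rot - y'.rot‖) := by positivity
  have p3 : ε ≤ κ * m * ε := le_mul_of_one_le_left hε hc.one_le_mul
  have p4 := mul_le_mul_of_nonneg_right (mul_le_mul_of_nonneg_left hc.norm_le
    (show 0 ≤ h / 2 by positivity)) hd
  have p5 : 0 ≤ h * (κ * m) * l2 (midVel Φ m D h a x - midVel Φ m D h a x') := by positivity
  nlinarith

end Stability

/-! ### Local and global order, midpoint velocities, conclusion. -/

section Convergence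

variable {n : ℕ} {Φ : ℝ → ℝ} {m : ℝ} {D : Matrix (Fin 3) (Fin 3) ℝ} {s : ℝ → Measurement n}
  {t₀ T B F κ C : ℝ}

/-- Uniform constants for stability and consistency of one step. -/
structure ErrorConstants (Φ : ℝ → ℝ) (m : ℝ) (D : Matrix (Fin 3) (Fin 3) ℝ)
    (s : ℝ → Measurement n) (t₀ T B κ C : ℝ) : Prop where
  pos : 0 < κ
  nonneg : 0 ≤ C
  step : ∀ t ∈ Icc t₀ T, ∀ t' ∈ Icc t₀ T, StepConstants Φ m D (s t) (s t') B κ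
  residual_le : ∀ (h : ℝ) (p q : SolutionPoint Φ m D s t₀ T B), 0 ≤ h → p.rel q → p.inc q = h →
    l2 (residual Φ m D h p.data q.data p.state q.state) ≤ C * h ^ 3
  rot_le : ∀ (h : ℝ) (p q : SolutionPoint Φ m D s t₀ T B), 0 ≤ h → p.rel q → p.inc q = h →
    ‖q.state.rot - p.state.rot * NormedSpace.exp (h • hat (midΩ p.data q.data -
      midVel Φ m D h p.data p.state))‖ ≤ C * h ^ 3
  midVel_le : ∀ (h : ℝ) (p q : SolutionPoint Φ m D s t₀ T B), 0 ≤ h → p.rel q →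
    p.inc q = h / 2 → l2 (midVel Φ m D h p.data p.state - q.state.ω) ≤ C * h ^ 2

theorem IsSmoothSignal.of_le {k r : ℕ} (hs : IsSmoothSignal r s t₀ T) (hkr : k ≤ r) :
    IsSmoothSignal k s t₀ T where
  Ω i := (hs.Ω i).of_le (by exact_mod_cast hkr)
  E i j := (hs.E i j).of_le (by exact_mod_cast hkr)
  U i j := (hs.U i j).of_le (by exact_mod_cast hkr)
  W i j := (hs.W i j).of_le (by exact_mod_cast hkr)

theorem exists_errorConstants (hm : 0 < m) (hD : D.PosDef)
    (hΦ : ContDiffOn ℝ 2 (derivWithin Φ (Ici 0)) (Ici 0)) (hT : t₀ < T)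
    (hW : ∀ t ∈ Icc t₀ T, (s t).W.PosDef) (hs : IsSmoothSignal 2 s t₀ T) (B : ℝ) :
    ∃ κ C, ErrorConstants Φ m D s t₀ T B κ C := by
  obtain ⟨K', hK'⟩ := SolutionPoint.exists_estimates (B := B) (D := D) hm hΦ hT hW hs
  obtain ⟨K, hB, hDK, hK⟩ : ∃ K, B ≤ K ∧ ‖D‖ ≤ K ∧ SolutionPoint.Estimates Φ m D s t₀ T B K := by
    refine ⟨max K' (max B ‖D‖), ?_, ?_, hK'.mono (le_max_left _ _)⟩
    · exact (le_max_left _ _).trans (le_max_right _ _)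
    · exact (le_max_right _ _).trans (le_max_right _ _)
  obtain ⟨L, hL⟩ := exists_forcing_lipschitz (hΦ.of_le (by norm_num)) hW
    (hs.of_le (Nat.zero_le 2))
  have hK0 := hK.nonneg
  -- Each summand serves one requirement of `StepConstants`: `κ` dominates `1` and `B`, and `κ * m`
  -- dominates `1`, `‖D‖` and `L`.
  set κ : ℝ := 1 + m⁻¹ + ‖D‖ / m + |B| + |L| / m with hκ
  have hκm : κ * m = m + 1 + ‖D‖ + |B| * m + |L| := by rw [hκ]; field_simp
  have hBm : 0 ≤ |B| * m := by positivity
  have hκ1 : 1 ≤ κ := by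
    have : 0 ≤ m⁻¹ + ‖D‖ / m + |B| + |L| / m := by positivity
    linarith
  have hlip : ∀ t ∈ Icc t₀ T, ∀ x y : FilterState,
      l2 (forcing Φ (s t) x - forcing Φ (s t) y) ≤ κ * m * ‖x.rot - y.rot‖ := by
    refine fun t ht x y => (hL t ht x y).trans (mul_le_mul_of_nonneg_right ?_ (norm_nonneg _))
    rw [hκm]
    linarith [le_abs_self L, norm_nonneg D]
  set C₁ := m * K + K * (K ^ 3 + K ^ 2 / m + K) + m * K ^ 3 + m * K ^ 4
  set C₂ := K ^ 3 + K ^ 2 / m + 2 * K + K ^ 2 + K ^ 3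
  set C₃ := K ^ 3 + K ^ 2 / m + K
  have h1 : 0 ≤ C₁ := by positivity
  have h2 : 0 ≤ C₂ := by positivity
  have h3 : 0 ≤ C₃ := by positivity
  refine ⟨κ, C₁ + C₂ + C₃, by linarith, by positivity, fun t ht t' ht' =>
    ⟨hκ1, ?_, ?_, ?_, hlip t ht, hlip t' ht'⟩, fun h p q hh hpq hinc => ?_,
    fun h p q hh hpq hinc => ?_, fun h p q hh hpq hinc => ?_⟩
  · rw [hκm]; linarith [abs_nonneg L, norm_nonneg D]
  · rw [hκm]; linarith [abs_nonneg L]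
  · have : 0 ≤ m⁻¹ + ‖D‖ / m + |L| / m := by positivity
    linarith [le_abs_self B]
  · exact (hK.l2_residual_le hm hD hB hDK hh hpq hinc).trans
      (mul_le_mul_of_nonneg_right (by linarith) (by positivity))
  · exact (hK.norm_rot_sub_le hm hD hB hDK hh hpq hinc).trans
      (mul_le_mul_of_nonneg_right (by linarith) (by positivity))
  · have b1 := hK.l2_midVel_sub_le hm hD hB hDK hh p
    have b2 := hK.ω_taylor p q hpq
    rw [hinc, sq_abs] at b2
    have e : midVel Φ m D h p.data p.state - q.state.ω =
        (midVel Φ m D h p.data p.state - p.state.ω - (h / 2) • accel Φ m D p.data p.state) -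
        (q.state.ω - p.state.ω - (h / 2) • accel Φ m D p.data p.state) := by abel
    rw [e]
    have b3 := (l2_sub_le _ _).trans (add_le_add b1 b2)
    have b4 : C₃ * h ^ 2 ≤ (C₁ + C₂ + C₃) * h ^ 2 :=
      mul_le_mul_of_nonneg_right (by linarith) (by positivity)
    have b5 : 0 ≤ K * h ^ 2 := by positivity
    refine b3.trans (le_trans ?_ b4)
    simp only [C₃]
    nlinarith

theorem ErrorConstants.stateDist_le (hc : ErrorConstants Φ m D s t₀ T B κ C) (hm : 0 < m)
    (hD : D.PosDef) {h : ℝ} (hh : 0 ≤ h) (hhκ : h * κ ≤ 1 / 4)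
    {p q : SolutionPoint Φ m D s t₀ T B} (hpq : p.rel q) (hinc : p.inc q = h) {x y : FilterState}
    (hxy : filter2 Φ m D h p.data q.data x y) :
    stateDist y q.state ≤ (1 + 16 * κ * h) * stateDist x p.state + 5 * κ * (C * h ^ 3) :=
  (hc.step p.τ p.mem_Icc q.τ q.mem_Icc).stateDist_le hm hD hh hhκ hxy (p.bound _ p.mem)
    (q.bound _ q.mem) (hc.rot_le h p q hh hpq hinc) (hc.residual_le h p q hh hpq hinc)

theorem step_mul_le {h : ℝ} (hκ : 0 < κ) (hh : h ≤ 1 / (4 * κ)) : h * κ ≤ 1 / 4 := by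
  rw [le_div_iff₀ (by positivity)] at hh
  linarith

/-- The stability estimate with zero initial distance leaves the defect alone. The solution is given
only on `[t, t + h]`, which is why solution points carry their own interval. -/
theorem hasLocalOrder_filter2 (hm : 0 < m) (hD : D.PosDef)
    (hB : ∀ M, ∃ B, ∀ a b, t₀ ≤ a → b ≤ T → ∀ x, IsFilterSolution Φ m D s a b x →
      ‖(x a).ω‖ ≤ M → ∀ t ∈ Icc a b, l2 (x t).ω ≤ B)
    (hc : ∀ B, ∃ κ C, ErrorConstants Φ m D s t₀ T B κ C) :
    HasLocalOrder 2 (filter2 Φ m D) Φ m D s t₀ T := by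
  intro M
  obtain ⟨B, hB⟩ := hB M
  obtain ⟨κ, C, hc⟩ := hc B
  have hκ := hc.pos
  refine ⟨5 * κ * C, 1 / (4 * κ), by positivity, fun h hpos hh t ht htT x hx hM y hy => ?_⟩
  let p : SolutionPoint Φ m D s t₀ T B :=
    ⟨t, t + h, t, x, ht, htT, ⟨le_rfl, by linarith⟩, hx, hB t (t + h) ht htT x hx hM⟩
  let q := p.move (t + h) ⟨by change t ≤ t + h; linarith, le_rfl⟩
  have h1 := hc.stateDist_le hm hD hpos.le (step_mul_le hκ hh) (p := p) (q := q)
    ⟨rfl, rfl, rfl⟩ (add_sub_cancel_left t h) hy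
  refine errorLE_of_stateDist_le (h1.trans (le_of_eq ?_))
  rw [show p.state = x t from rfl, stateDist_self]
  ring

theorem exists_global_bound (hm : 0 < m) (hD : D.PosDef)
    (hc : ErrorConstants Φ m D s t₀ T B κ C) {h : ℝ} (hpos : 0 < h) (hh : h ≤ 1 / (4 * κ))
    {N : ℕ} (hN : t₀ + N * h ≤ T) {x : ℝ → FilterState} (hx : IsFilterSolution Φ m D s t₀ T x)
    (hB : ∀ t ∈ Icc t₀ T, l2 (x t).ω ≤ B) {y : Fin (N + 1) → FilterState} (hy0 : y 0 = x t₀)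
    (hy : IsTrajectory (filter2 Φ m D) s t₀ h N y) (i : Fin (N + 1)) :
    stateDist (y i) (x (t₀ + (i : ℕ) * h)) ≤ Real.exp (16 * κ * (T - t₀)) * C * h ^ 2 := by
  have hκ := hc.pos
  have hC := hc.nonneg
  let p : ∀ i : ℕ, i ≤ N → SolutionPoint Φ m D s t₀ T B := fun i hi =>
    ⟨t₀, T, t₀ + i * h, x, le_rfl, le_rfl, grid_mem hpos hN hi, hx, hB⟩
  have h0 : stateDist (y 0) (x (t₀ + ((0 : Fin (N + 1)) : ℕ) * h)) = 0 := by
    rw [Fin.val_zero, Nat.cast_zero, zero_mul, add_zero, hy0, stateDist_self]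
  -- The choice of `q` makes `p * q = 5 * κ * (C * h ^ 3)`, the defect contributed by one step.
  have h1 := discrete_gronwall (u := fun i => stateDist (y i) (x (t₀ + (i : ℕ) * h)))
    (p := 16 * κ * h) (q := 5 / 16 * C * h ^ 2) (by positivity)
    (add_nonneg (stateDist_nonneg _ _) (by positivity)) (fun i => by
      have hi1 : (i : ℕ) + 1 ≤ N := i.2
      have h2 := hc.stateDist_le hm hD hpos.le (step_mul_le hκ hh) (p := p i i.2.le)
        (q := p (i + 1) hi1) ⟨rfl, rfl, rfl⟩ (by
          change t₀ + ((i : ℕ) + 1 : ℕ) * h - (t₀ + (i : ℕ) * h) = h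
          push_cast; ring) (x := y i.castSucc) (y := y i.succ) (by
          have := hy i
          rw [← Nat.cast_succ] at this
          exact this)
      refine h2.trans (le_of_eq ?_)
      rw [Fin.val_castSucc]
      simp only [SolutionPoint.state, p]
      ring) i
  simp only [h0, zero_add] at h1
  have h2 := mul_le_mul_of_nonneg_right (exp_grid_le (L := 16 * κ) (by positivity) hpos hN i)
    (show 0 ≤ 5 / 16 * C * h ^ 2 by positivity)
  have h3 : 0 ≤ 5 / 16 * C * h ^ 2 := by positivity
  have h4 : 0 ≤ Real.exp (16 * κ * (T - t₀)) * (C * h ^ 2) := by positivity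
  nlinarith

theorem hasGlobalOrder_filter2 (hm : 0 < m) (hD : D.PosDef)
    (hB : ∀ M, ∃ B, ∀ a b, t₀ ≤ a → b ≤ T → ∀ x, IsFilterSolution Φ m D s a b x →
      ‖(x a).ω‖ ≤ M → ∀ t ∈ Icc a b, l2 (x t).ω ≤ B)
    (hc : ∀ B, ∃ κ C, ErrorConstants Φ m D s t₀ T B κ C) :
    HasGlobalOrder 2 (filter2 Φ m D) Φ m D s t₀ T := by
  intro M
  obtain ⟨B, hB⟩ := hB M
  obtain ⟨κ, C, hc⟩ := hc B
  have hκ := hc.pos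
  exact ⟨Real.exp (16 * κ * (T - t₀)) * C, 1 / (4 * κ), by positivity,
    fun h hpos hh N hN x hx hM y hy0 hy i => errorLE_of_stateDist_le
      (exists_global_bound hm hD hc hpos hh hN hx (hB t₀ T le_rfl le_rfl x hx hM) hy0 hy i)⟩

/-- The error is that of `midVel` evaluated at the numerical instead of the exact state, at most
twice the global error as `h * κ ≤ 1 / 4`, plus the consistency error of `midVel` on the exact
solution. -/
theorem midVelApproximates (hm : 0 < m) (hD : D.PosDef)
    (hB : ∀ M, ∃ B, ∀ a b, t₀ ≤ a → b ≤ T → ∀ x, IsFilterSolution Φ m D s a b x →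
      ‖(x a).ω‖ ≤ M → ∀ t ∈ Icc a b, l2 (x t).ω ≤ B)
    (hc : ∀ B, ∃ κ C, ErrorConstants Φ m D s t₀ T B κ C) :
    MidVelApproximates Φ m D s t₀ T := by
  intro M
  obtain ⟨B, hB⟩ := hB M
  obtain ⟨κ, C, hc⟩ := hc B
  have hκ := hc.pos
  refine ⟨2 * (Real.exp (16 * κ * (T - t₀)) * C) + C, 1 / (4 * κ), by positivity,
    fun h hpos hh N hN x hx hM y hy0 hy i k => ?_⟩
  have hbd := hB t₀ T le_rfl le_rfl x hx hM
  have hu := exists_global_bound hm hD hc hpos hh hN hx hbd hy0 hy i.castSucc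
  have hi := grid_mem hpos hN i.2.le
  have hi' := grid_mem hpos hN (Nat.succ_le_of_lt i.2)
  rw [Nat.cast_succ] at hi'
  let p : SolutionPoint Φ m D s t₀ T B := ⟨t₀, T, t₀ + (i : ℕ) * h, x, le_rfl, le_rfl, hi, hx, hbd⟩
  let q := p.move (t₀ + (i : ℕ) * h + h / 2) ⟨by linarith [hi.1], by linarith [hi'.2]⟩
  have h1 := hc.midVel_le h p q hpos.le ⟨rfl, rfl, rfl⟩ (add_sub_cancel_left _ _)
  have h2 := (hc.step _ hi _ hi).l2_midVel_sub_midVel_le (x := y i.castSucc) hm hD hpos.le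
    (hbd _ hi)
  have hκh := step_mul_le hκ hh
  have h3 : l2 (midVel Φ m D h (s (t₀ + (i : ℕ) * h)) (y i.castSucc) -
      midVel Φ m D h (s (t₀ + (i : ℕ) * h)) (x (t₀ + (i : ℕ) * h))) ≤
      2 * stateDist (y i.castSucc) (x (t₀ + (i : ℕ) * h)) := by
    refine h2.trans ?_
    have e1 := l2_nonneg ((y i.castSucc).ω - (x (t₀ + (i : ℕ) * h)).ω)
    have e2 := norm_nonneg ((y i.castSucc).rot - (x (t₀ + (i : ℕ) * h)).rot)
    rw [stateDist]
    nlinarith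
  have h4 := l2_add_le (midVel Φ m D h (s (t₀ + (i : ℕ) * h)) (y i.castSucc) -
      midVel Φ m D h (s (t₀ + (i : ℕ) * h)) (x (t₀ + (i : ℕ) * h)))
    (midVel Φ m D h (s (t₀ + (i : ℕ) * h)) (x (t₀ + (i : ℕ) * h)) -
      (x (t₀ + (i : ℕ) * h + h / 2)).ω)
  rw [sub_add_sub_cancel] at h4
  refine (abs_apply_le_l2 (_ - _) k).trans (h4.trans ((add_le_add h3 h1).trans ?_))
  rw [Fin.val_castSucc] at hu
  linarith

end Convergence

end AttitudeFilter

theorem mainTheorem7 {n : ℕ} (Φ : ℝ → ℝ) (hΦ : AttitudeFilter.IsShapeFunction Φ)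
    (m : ℝ) (hm : 0 < m) (D : Matrix (Fin 3) (Fin 3) ℝ) (hD : D.PosDef) :
    -- the inverse in the intermediate value exists for every nonnegative step
    (∀ h : ℝ, 0 ≤ h → IsUnit (m • (1 : Matrix (Fin 3) (Fin 3) ℝ) + (h / 2) • D)) ∧
    -- the half-step adjoint is explicit, with the closed-form intermediate value
    (∀ (h : ℝ) (a c : AttitudeFilter.Measurement n) (x z : AttitudeFilter.FilterState),
      IsUnit (m • (1 : Matrix (Fin 3) (Fin 3) ℝ) + (h / 2) • D) →
      ((AttitudeFilter.lgvi Φ m D).adjoint (h / 2) a c x z ↔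
        z.ω = AttitudeFilter.midVel Φ m D h a x ∧
        z.rot = x.rot * NormedSpace.exp ((h / 2) •
          AttitudeFilter.hat (c.Ω - AttitudeFilter.midVel Φ m D h a x)))) ∧
    -- the composition of the two half steps is the displayed filter
    (∀ (h : ℝ) (a c b : AttitudeFilter.Measurement n) (x y : AttitudeFilter.FilterState),
      IsUnit (m • (1 : Matrix (Fin 3) (Fin 3) ℝ) + (h / 2) • D) →
      c.Ω = AttitudeFilter.midΩ a b →
      (AttitudeFilter.strang (AttitudeFilter.lgvi Φ m D) h a c b x y ↔
        AttitudeFilter.filter2 Φ m D h a b x y)) ∧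
    -- the filter is symmetric, that is, self-adjoint
    (∀ (h : ℝ) (a b : AttitudeFilter.Measurement n) (x y : AttitudeFilter.FilterState),
      IsUnit (m • (1 : Matrix (Fin 3) (Fin 3) ℝ) + (h / 2) • D) →
      IsUnit (m • (1 : Matrix (Fin 3) (Fin 3) ℝ) - (h / 2) • D) →
      ((AttitudeFilter.filter2 Φ m D).adjoint h a b x y ↔
        AttitudeFilter.filter2 Φ m D h a b x y)) ∧
    -- along measurement signals on a time interval
    (∀ (s : ℝ → AttitudeFilter.Measurement n) (t₀ T : ℝ), t₀ < T →
      (∀ t ∈ Set.Icc t₀ T, (s t).W.PosDef) →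
      AttitudeFilter.IsSmoothSignal 0 s t₀ T →
      -- the implicit update is uniquely solvable for small steps
      AttitudeFilter.IsReversibleMap (AttitudeFilter.filter2 Φ m D) s t₀ T ∧
      AttitudeFilter.IsWellPosed (AttitudeFilter.filter2 Φ m D) s t₀ T ∧
      -- for smooth data the filter has order two
      (ContDiffOn ℝ 3 Φ (Set.Ici 0) → AttitudeFilter.IsSmoothSignal 2 s t₀ T →
        AttitudeFilter.HasLocalOrder 2 (AttitudeFilter.filter2 Φ m D) Φ m D s t₀ T ∧
        AttitudeFilter.HasGlobalOrder 2 (AttitudeFilter.filter2 Φ m D) Φ m D s t₀ T ∧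
        AttitudeFilter.MidVelApproximates Φ m D s t₀ T)) := by
  have hu2 : UniqueDiffOn ℝ (Set.Ici (0 : ℝ)) := uniqueDiffOn_Ici 0
  have hΦ' : ContDiffOn ℝ 1 (derivWithin Φ (Set.Ici 0)) (Set.Ici 0) :=
    hΦ.contDiffOn.derivWithin hu2 (by norm_num)
  refine ⟨fun h hh => AttitudeFilter.isUnit_smul_one_add_smul hm hD hh,
    fun h a c x z hu => AttitudeFilter.lgvi_adjoint_iff hu,
    fun h a c b x y hu hc => AttitudeFilter.strang_lgvi_iff hu hc,
    fun h a b x y hu hu' => AttitudeFilter.filter2_symm hu hu',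
    fun s t₀ T hT hW hs => ?_⟩
  obtain ⟨F, hF⟩ := AttitudeFilter.exists_forcing_bound hΦ'.continuousOn hW hs
  -- Any state, here the identity rotation at rest, shows that the bound is nonnegative.
  have hF0 : 0 ≤ F := (AttitudeFilter.l2_nonneg _).trans (hF t₀ ⟨le_rfl, hT.le⟩ ⟨1, 0⟩)
  refine ⟨AttitudeFilter.isReversibleMap_filter2 hm hF,
    AttitudeFilter.isWellPosed_filter2 hm hD hF0 hF, fun hΦ3 hs2 => ?_⟩
  have hB := AttitudeFilter.exists_l2_ω_bound (Φ := Φ) hm hD hF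
  have hc := AttitudeFilter.exists_errorConstants hm hD
    (hΦ3.derivWithin (m := 2) hu2 (by norm_num)) hT hW hs2
  exact ⟨AttitudeFilter.hasLocalOrder_filter2 hm hD hB hc,
    AttitudeFilter.hasGlobalOrder_filter2 hm hD hB hc,
    AttitudeFilter.midVelApproximates hm hD hB hc⟩
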